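/- **Theorem (Optimal Direct Product Theorem).** Let $f\colon X\to\{0,1\}$ with $X\subseteq\{0,1\}^m$ be a (possibly partial) Boolean function and let $f^n\colon X^n\to\{0,1\}^n$, $f^n(x^{(1)},\dots,x^{(n)})=(f(x^{(1)}),\dots,f(x^{(n)}))$, be its $n$-fold direct product. A randomized algorithm $R$ is a probability distribution over deterministic decision trees $D$, and the cost of $D$ on $x$ is the depth of the leaf $D(x)$ that $x$ reaches. Let $\mathrm{R}_{s}(f^n)$ be the minimum, over randomized algorithms that output $f^n(x)$ with probability at least $s$ on every $x\in X^n$, of the maximum cost over all $x\in X^n$ and all trees in the support. For a distribution $\mu$ on $X$ let $\overline{\overline{\mathrm R}}{}^{\mu}_\gamma(f)$ be the minimum expected cost of a randomized algorithm that outputs $f(x)$ with probability at least $\gamma$, where both the expected cost and the success probability are taken over $x\sim\mu$ and the internal randomness, and let $\overline{\overline{\mathrm R}}_\gamma(f)=\max_\mu\overline{\overline{\mathrm R}}{}^{\mu}_\gamma(f)$. 1. There is a universal constant $c_1>0$ such that for all $m$, all such $f$, all $\frac12<\gamma<1$ and all $n\ge1$, $$\mathrm R_{\gamma^n}(f^n)\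 \ge\ c_1\, n\,\overline{\overline{\mathrm R}}_\gamma(f).$$ 2. There are universal constants $c,C>0$ such that for all $m$, all such $f$, all $\frac12<\gamma<1$ and all $n\ge c/\min\{2\gamma-1,1-\gamma\}^2$, $$\mathrm R_{\gamma^n}(f^n)\ \le\ C\, n\,\overline{\overline{\mathrm R}}_\gamma(f).$$ 3. The lower bound also holds for arbitrary score measures. A score function is a continuous $\phi\colon[0,1]\to[\frac12,1]$ with $\phi(0)=\phi(1)=1$, $\phi(\frac12)=\frac12$, $\phi(p)=\phi(1-p)$, that is monotonically increasing on $[\frac12,1]$. Identify a leaf $\ell$ with the set of inputs in the domain that reach it. For a distribution $\mu$ on $X$ and $\ell\subseteq X$ put $\mathrm{score}^\mu_f(\ell)=\phi\big(\mu(\ell\cap f^{-1}(1))/\mu(\ell)\big)$; the score of a randomized algorithm $R$ for $f$ is $\mathbb E_{D\sim R}\,\mathbb E_{x\sim\mu}\,\mathrm{score}^\mu_f(D(x))$. A leaf of a decision tree for $f^n$ is a product $\ell=\ell^{(1)}\times\dots\times\ell^{(n)}$; its score with respect to $\mu^n$ is $\prod_i\mathrm{score}^\mu_f(\ell^{(i)})$,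 and the score of a randomized algorithm for $f^n$ with respect to $\mu^n$ is again the expected score of the leaf reached. Let $\overline{\overline{\mathrm R}}_{\phi,\gamma}(f)$ be the maximum over $\mu$ of the minimum expected cost over $\mu$ of a randomized algorithm with score at least $\gamma$ with respect to $f$ and $\mu$, and let $\mathrm R_{\phi,s}(f^n)$ be the minimum worst-case cost of a randomized algorithm whose score with respect to $\mu^n$ is at least $s$ for every distribution $\mu$ on $X$. There is a universal constant $c_2>0$ such that for every score function $\phi$, all $m$, all $f$, all $\frac12<\gamma<1$ and all $n\ge1$, $$\mathrm R_{\phi,\gamma^n}(f^n)\ \ge\ c_2\, n\,\overline{\overline{\mathrm R}}_{\phi,\gamma}(f).$$ -/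

import Mathlib

open scoped ENNReal

noncomputable section

/-- Deterministic decision trees over input bits indexed by `ι`, with leaves labelled in `O`.
In `query i t₀ t₁` the bit `i` is queried; the tree continues with `t₀` if the bit is `false`
and with `t₁` if it is `true`. -/
inductive DTree (ι O : Type) : Type
  | leaf (o : O) : DTree ι O
  | query (i : ι) (t₀ t₁ : DTree ι O) : DTree ι O

/-- The output of the tree on an input: the label of the leaf it reaches. -/
def DTree.eval {ι O : Type} : DTree ι O → (ι → Bool) → O
  | .leaf o, _ => o
  | .query i t₀ t₁, x => if x i then t₁.eval x else t₀.eval x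

/-- The number of queries made on an input: the depth of the leaf it reaches. -/
def DTree.cost {ι O : Type} : DTree ι O → (ι → Bool) → ℕ
  | .leaf _, _ => 0
  | .query i t₀ t₁, x => 1 + if x i then t₁.cost x else t₀.cost x

/-- The sequence of edge labels from the root to the leaf reached by an input.
Two inputs reach the same leaf exactly when they have the same path. -/
def DTree.path {ι O : Type} : DTree ι O → (ι → Bool) → List Bool
  | .leaf _, _ => []
  | .query i t₀ t₁, x => x i :: if x i then t₁.path x else t₀.path x

/-- A randomized algorithm: a probability distribution over deterministic decision trees. -/
abbrev RandAlg (ι O : Type) : Type := PMF (DTree ι O)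

/-- Absolute worst-case cost: the maximum over inputs in the domain and over the trees in the
support. -/
def worstCost {ι O : Type} (X : Set (ι → Bool)) (R : RandAlg ι O) : ℝ≥0∞ :=
  ⨆ x ∈ X, ⨆ D ∈ R.support, (D.cost x : ℝ≥0∞)

/-- The probability, over the internal randomness of `R`, that `R` outputs `f x` on input `x`. -/
def successProb {ι O : Type} {X : Set (ι → Bool)} (f : X → O) (R : RandAlg ι O) (x : X) : ℝ≥0∞ :=
  (R.map fun D => D.eval x.1) (f x)

/-- Worst-case randomized query complexity of the (partial) function `f` with domain `X`, for
success probability `γ` on every input of the domain. -/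
def worstR {ι O : Type} {X : Set (ι → Bool)} (f : X → O) (γ : ℝ) : ℝ≥0∞ :=
  ⨅ (R : RandAlg ι O) (_ : ∀ x : X, ENNReal.ofReal γ ≤ successProb f R x), worstCost X R

/-- Expected cost of `R` over both its internal randomness and the input drawn from `μ`. -/
def avgCost {ι O : Type} {X : Set (ι → Bool)} (μ : PMF X) (R : RandAlg ι O) : ℝ≥0∞ :=
  ∑' x : X, μ x * ∑' D : DTree ι O, R D * (D.cost x.1 : ℝ≥0∞)

/-- Success probability of `R` over both its internal randomness and the input drawn from `μ`. -/
def avgSuccess {ι O : Type} {X : Set (ι → Bool)} (f : X → O) (μ : PMF X) (R : RandAlg ι O) :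
    ℝ≥0∞ :=
  ∑' x : X, μ x * successProb f R x

/-- Distributional complexity of `f` with respect to `μ`. -/
def distR {ι O : Type} {X : Set (ι → Bool)} (f : X → O) (μ : PMF X) (γ : ℝ) : ℝ≥0∞ :=
  ⨅ (R : RandAlg ι O) (_ : ENNReal.ofReal γ ≤ avgSuccess f μ R), avgCost μ R

/-- Maximum distributional complexity of `f`. -/
def maxDistR {ι O : Type} {X : Set (ι → Bool)} (f : X → O) (γ : ℝ) : ℝ≥0∞ :=
  ⨆ μ : PMF X, distR f μ γ

/-- The domain `Xⁿ` of the `n`-fold direct product, as a set of inputs with `n * m` bits. -/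
def powDomain {m : ℕ} (X : Set (Fin m → Bool)) (n : ℕ) : Set (Fin n × Fin m → Bool) :=
  {x | ∀ i, (fun j => x (i, j)) ∈ X}

/-- The `n`-fold direct product `fⁿ` of `f`. -/
def powFun {m : ℕ} {X : Set (Fin m → Bool)} (f : X → Bool) (n : ℕ) :
    powDomain X n → (Fin n → Bool) :=
  fun x i => f ⟨fun j => x.1 (i, j), x.2 i⟩

/-- The score functions: bounded, normalized, symmetric, monotone and continuous functions on
`[0, 1]`. -/
structure IsScoreFunction (φ : ℝ → ℝ) : Prop where
  bounded : ∀ p ∈ Set.Icc (0 : ℝ) 1, φ p ∈ Set.Icc (1 / 2 : ℝ) 1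
  map_zero : φ 0 = 1
  map_one : φ 1 = 1
  map_half : φ (1 / 2) = 1 / 2
  symm : ∀ p ∈ Set.Icc (0 : ℝ) 1, φ p = φ (1 - p)
  mono : MonotoneOn φ (Set.Icc (1 / 2 : ℝ) 1)
  cont : ContinuousOn φ (Set.Icc (0 : ℝ) 1)

/-- The score `φ (μ(ℓ₁) / μ(ℓ))` of a set `L = ℓ` of inputs, where `ℓ₁ = ℓ ∩ f⁻¹(1)`.
(It is only used with a positive weight when `μ(ℓ) > 0`.) -/
def setScore {ι : Type} {X : Set (ι → Bool)} (φ : ℝ → ℝ) (f : X → Bool) (μ : PMF X)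
    (L : Set X) : ℝ :=
  φ (μ.toOuterMeasure (L ∩ f ⁻¹' {true}) / μ.toOuterMeasure L).toReal

/-- The score of a randomized algorithm with respect to `f` and `μ`: the expected score of the
leaf that is reached. The labels of the leaves play no role. -/
def avgScore {ι : Type} {X : Set (ι → Bool)} (φ : ℝ → ℝ) (f : X → Bool) (μ : PMF X)
    (R : RandAlg ι Bool) : ℝ≥0∞ :=
  ∑' D : DTree ι Bool, R D * ∑' x : X, μ x *
    ENNReal.ofReal (setScore φ f μ {y | D.path y.1 = D.path x.1})

/-- Distributional complexity of `f` with respect to `μ`, for the score measure of `φ`. -/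
def distScoreR {ι : Type} {X : Set (ι → Bool)} (φ : ℝ → ℝ) (f : X → Bool) (μ : PMF X) (γ : ℝ) :
    ℝ≥0∞ :=
  ⨅ (R : RandAlg ι Bool) (_ : ENNReal.ofReal γ ≤ avgScore φ f μ R), avgCost μ R

/-- Maximum distributional complexity of `f`, for the score measure of `φ`. -/
def maxDistScoreR {ι : Type} {X : Set (ι → Bool)} (φ : ℝ → ℝ) (f : X → Bool) (γ : ℝ) : ℝ≥0∞ :=
  ⨆ μ : PMF X, distScoreR φ f μ γ

/-- The concatenation of `n` inputs of `f` to one input of `fⁿ`. -/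
def joinInputs {m n : ℕ} {X : Set (Fin m → Bool)} (z : Fin n → X) : Fin n × Fin m → Bool :=
  fun p => (z p.1).1 p.2

/-- The factor `ℓ⁽ⁱ⁾` of the leaf `ℓ = ℓ⁽¹⁾ × ⋯ × ℓ⁽ⁿ⁾` of `D` reached by the input `z`: since
`ℓ` is a product set, `ℓ⁽ⁱ⁾` consists of the `y` such that replacing the `i`-th instance in `z`
by `y` gives an input that reaches `ℓ` too. -/
def leafFactor {m n : ℕ} {X : Set (Fin m → Bool)} (D : DTree (Fin n × Fin m) (Fin n → Bool))
    (z : Fin n → X) (i : Fin n) : Set X :=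
  {y | D.path (joinInputs (Function.update z i y)) = D.path (joinInputs z)}

/-- The score of a randomized algorithm for `fⁿ` with respect to the product distribution `μⁿ`:
the expected value of the product of the scores of the factors of the leaf that is reached. -/
def powScore {m n : ℕ} {X : Set (Fin m → Bool)} (φ : ℝ → ℝ) (f : X → Bool) (μ : PMF X)
    (R : RandAlg (Fin n × Fin m) (Fin n → Bool)) : ℝ≥0∞ :=
  ∑' D : DTree (Fin n × Fin m) (Fin n → Bool), R D * ∑' z : Fin n → X, (∏ i, μ (z i)) *
    ∏ i, ENNReal.ofReal (setScore φ f μ (leafFactor D z i))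

/-- Worst-case randomized query complexity of `fⁿ` for the score measure of `φ`: the least
worst-case cost of a randomized algorithm whose score is at least `s` for every `μⁿ`. -/
def worstPowScoreR {m : ℕ} {X : Set (Fin m → Bool)} (φ : ℝ → ℝ) (f : X → Bool) (n : ℕ) (s : ℝ) :
    ℝ≥0∞ :=
  ⨅ (R : RandAlg (Fin n × Fin m) (Fin n → Bool))
    (_ : ∀ μ : PMF X, ENNReal.ofReal s ≤ powScore φ f μ R), worstCost (powDomain X n) R

end

/-! Lower bounds. Price each query at `l / 2` and let `optValue` be the best expected reward minus
price on a set of inputs. Guessing earns half the mass, so `optValue` is at least `mass / 2`; since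
a query costs `l / 2` times the mass, revealing one bit raises the value by a factor of at most `1 +
l ≤ exp l` (`optValue_split_le`). If the product reward of a tree for `n` instances is discounted by
`exp (-l)` per query, induction on the tree bounds it by the product of the `optValue`s
(`prodGain_le_prod_optValue`). With worst-case cost `B`, removing the discount and taking `n`-th
roots gives single-instance value at least `γ - l * B / n` for every `l ≥ 0`. Minimax over the pair
(reward, cost) turns this family of bounds into one algorithm of reward `γ` and expected cost
arbitrarily close to `2 * B / n`. Success probability and score are both instances of `IsReward`, so
one argument serves both.

Upper bound. Minimax over inputs gives an algorithm whose success minus weighted cost is nearly as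
good on every input as the distributional complexity promises, with success slightly below `γ`. A
majority of three runs lifts it above `γ` at triple cost. Independent copies run one after another
on a shared budget of order `n * T`, where `T` is `maxDistR f γ`; once it is exhausted, coins are
flipped. For large `n` the accumulated surplus over `γ ^ n` pays for the runs that exhaust the
budget. Near `1 / 2` this is tracked by an exponential potential (`worstR_powFun_le_of_sub_cost`),
near `1` by a linear one (`worstR_powFun_le_of_markov`). -/

/-! ### Minimax by convex separation -/

/-- If the hull misses the open orthant above `v - ε`, a functional `F` separates them. The orthant
is closed upwards, so `F` has nonpositive coefficients; normalising `-F` gives weights that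
contradict `h`. The slack `ε` makes the orthant open and puts `v` in it. -/
theorem exists_mem_convexHull_forall_lt {ι T : Type} [Fintype ι] [Nonempty ι] (g : T → ι → ℝ)
    (v : ι → ℝ) {ε : ℝ} (hε : 0 < ε)
    (h : ∀ w : ι → ℝ, (∀ i, 0 ≤ w i) → ∑ i, w i = 1 →
      ∃ t, ∑ i, w i * v i ≤ ∑ i, w i * g t i) :
    ∃ s ∈ convexHull ℝ (Set.range g), ∀ i, v i - ε < s i := by
  classical
  by_contra hcon
  push Not at hcon
  set U : Set (ι → ℝ) := Set.univ.pi fun i => Set.Ioi (v i - ε) with hU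
  have hUo : IsOpen U := isOpen_set_pi Set.finite_univ fun i _ => isOpen_Ioi
  have hUc : Convex ℝ U := convex_pi fun i _ => convex_Ioi _
  have hdisj : Disjoint U (convexHull ℝ (Set.range g)) := by
    rw [Set.disjoint_left]
    intro s hs hs'
    obtain ⟨i, hi⟩ := hcon s hs'
    exact absurd (hs i trivial) (not_lt.mpr hi)
  obtain ⟨F, u, hF1, hF2⟩ := geometric_hahn_banach_open hUc hUo (convex_convexHull ℝ _) hdisj
  have hFsum : ∀ x : ι → ℝ, F x = ∑ i, x i * F (Pi.single i 1) := by
    intro x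
    conv_lhs => rw [← Finset.univ_sum_single x]
    rw [map_sum]
    refine Finset.sum_congr rfl fun i _ => ?_
    have : (Pi.single i (x i) : ι → ℝ) = x i • Pi.single i 1 := by
      rw [← Pi.single_smul]; simp
    rw [this, map_smul, smul_eq_mul]
  have hvU : v ∈ U := fun i _ => by simp [hε]
  have hneg : ∀ i, F (Pi.single i 1) ≤ 0 := by
    intro i
    by_contra hpos
    push Not at hpos
    set k := (u - F v) / F (Pi.single i 1) with hk
    have hk0 : 0 ≤ k := div_nonneg (by linarith [hF1 v hvU]) hpos.le
    have hmem : v + k • Pi.single i (1 : ℝ) ∈ U := by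
      intro j _
      have : (0 : ℝ) ≤ k * (Pi.single i (1 : ℝ) : ι → ℝ) j := by
        refine mul_nonneg hk0 ?_
        by_cases hij : j = i
        · subst hij; simp
        · simp [hij]
      simp only [Set.mem_Ioi, Pi.add_apply, Pi.smul_apply, smul_eq_mul]
      linarith
    have := hF1 _ hmem
    rw [map_add, map_smul, smul_eq_mul, hk, div_mul_cancel₀ _ hpos.ne'] at this
    linarith
  obtain ⟨i₀⟩ := ‹Nonempty ι›
  obtain ⟨t₀, -⟩ := h (Pi.single i₀ 1)
    (fun i => by by_cases hij : i = i₀ <;> [(subst hij; simp); simp [hij]]) (by simp)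
  set W := ∑ i, -F (Pi.single i 1) with hW
  have hWnn : 0 ≤ W := Finset.sum_nonneg fun i _ => by linarith [hneg i]
  -- If all coefficients vanished, `F = 0` could not separate strictly; this needs a point of the
  -- hull, hence `t₀`.
  have hW0 : W ≠ 0 := by
    intro h0
    have hz : ∀ i, F (Pi.single i 1) = 0 := by
      intro i
      have := (Finset.sum_eq_zero_iff_of_nonneg
        (fun i _ => by linarith [hneg i])).1 (hW.symm.trans h0) i (Finset.mem_univ i)
      linarith
    have hF0 : ∀ x, F x = 0 := fun x => by rw [hFsum]; simp [hz]
    have h1 := hF1 v hvU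
    have h2 := hF2 (g t₀) (subset_convexHull ℝ _ ⟨t₀, rfl⟩)
    rw [hF0] at h1 h2
    linarith
  have hWpos : 0 < W := lt_of_le_of_ne hWnn hW0.symm
  obtain ⟨t, ht⟩ := h (fun i => -F (Pi.single i 1) / W)
    (fun i => div_nonneg (by linarith [hneg i]) hWnn)
    (by rw [← Finset.sum_div, ← hW, div_self hW0])
  have hconv : ∀ x : ι → ℝ, ∑ i, -F (Pi.single i 1) / W * x i = -F x / W := by
    intro x
    rw [hFsum x, ← Finset.sum_neg_distrib, Finset.sum_div]
    exact Finset.sum_congr rfl fun i _ => by ring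
  rw [hconv, hconv, div_le_div_iff_of_pos_right hWpos] at ht
  have h1 := hF1 v hvU
  have h2 := hF2 (g t) (subset_convexHull ℝ _ ⟨t, rfl⟩)
  linarith

/-- A point in the convex hull of a family is the expectation of the family under a finitely
supported distribution; `E` is the expectation functional. -/
theorem exists_pmf_of_mem_convexHull {ι T : Type} (g : T → ι → ℝ) {s : ι → ℝ}
    (hs : s ∈ convexHull ℝ (Set.range g)) :
    ∃ (R : PMF T) (E : (T → ℝ) →ₗ[ℝ] ℝ), (∀ i, E (fun t => g t i) = s i) ∧
      E (fun _ => 1) = 1 ∧ (∀ h, (∀ t, 0 ≤ h t) → 0 ≤ E h) ∧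
      ∀ h : T → ℝ, (∀ t, 0 ≤ h t) → ∑' t, R t * ENNReal.ofReal (h t) = ENNReal.ofReal (E h) := by
  classical
  rw [mem_convexHull_iff_exists_fintype] at hs
  obtain ⟨κ, _, a, z, ha0, ha1, hz, hs⟩ := hs
  choose D hD using hz
  refine ⟨(PMF.ofFintype (fun k => ENNReal.ofReal (a k)) (by
      rw [← ENNReal.ofReal_sum_of_nonneg fun k _ => ha0 k, ha1, ENNReal.ofReal_one])).bind
      (fun k => PMF.pure (D k)),
    ∑ k, a k • LinearMap.proj (D k), ?_, ?_, ?_, ?_⟩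
  · intro i
    rw [← hs]
    simp [hD]
  · simpa using ha1
  · intro h hh
    simp only [LinearMap.coe_sum, LinearMap.coe_smul, Finset.sum_apply, Pi.smul_apply,
      LinearMap.proj_apply, smul_eq_mul]
    exact Finset.sum_nonneg fun k _ => mul_nonneg (ha0 k) (hh _)
  · intro h hh
    simp only [LinearMap.coe_sum, LinearMap.coe_smul, Finset.sum_apply, Pi.smul_apply,
      LinearMap.proj_apply, smul_eq_mul]
    rw [ENNReal.ofReal_sum_of_nonneg fun k _ => mul_nonneg (ha0 k) (hh _)]
    simp only [PMF.bind_apply, tsum_fintype, PMF.ofFintype_apply, PMF.pure_apply,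
      Finset.sum_mul]
    rw [Summable.tsum_finsetSum fun _ _ => ENNReal.summable]
    refine Finset.sum_congr rfl fun k _ => ?_
    rw [tsum_eq_single (D k) (fun t ht => by simp [ht]), ENNReal.ofReal_mul (ha0 k)]
    simp

/-! ### Expectations under `PMF` operations -/

theorem PMF.tsum_bind_mul {α β : Type} (p : PMF α) (k : α → PMF β) (F : β → ℝ≥0∞) :
    ∑' b, (p.bind k) b * F b = ∑' a, p a * ∑' b, k a b * F b := by
  simp only [PMF.bind_apply, ← ENNReal.tsum_mul_right, ← ENNReal.tsum_mul_left]
  rw [ENNReal.tsum_comm]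
  simp only [mul_assoc]

theorem PMF.tsum_pure_mul {α : Type} (a : α) (F : α → ℝ≥0∞) :
    ∑' b, PMF.pure a b * F b = F a := by
  rw [tsum_eq_single a (fun b hb => by simp [hb])]
  simp

theorem PMF.tsum_map_mul {α β : Type} (p : PMF α) (g : α → β) (F : β → ℝ≥0∞) :
    ∑' b, (p.map g) b * F b = ∑' a, p a * F (g a) := by
  rw [PMF.map, PMF.tsum_bind_mul]
  simp only [Function.comp_apply, PMF.tsum_pure_mul]

theorem PMF.tsum_const_mul {α : Type} (p : PMF α) (c : ℝ≥0∞) : ∑' a, p a * c = c := by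
  rw [ENNReal.tsum_mul_right, p.tsum_coe, one_mul]

open Classical in
theorem PMF.map_apply_eq_tsum {α β : Type} (p : PMF α) (g : α → β) (b : β) :
    (p.map g) b = ∑' a, p a * if g a = b then 1 else 0 := by
  rw [PMF.map_apply]
  exact tsum_congr fun a => by simp [eq_comm]

theorem DTree.query_path_eq_iff {ι O : Type} (j : ι) (t₀ t₁ : DTree ι O) (x y : ι → Bool) :
    (DTree.query j t₀ t₁).path y = (DTree.query j t₀ t₁).path x ↔
      y j = x j ∧ (if x j then t₁.path y = t₁.path x else t₀.path y = t₀.path x) := by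
  simp only [DTree.path, List.cons.injEq]
  refine and_congr_right fun h => ?_
  rw [h]
  split <;> rfl

/-! ### Rewards and optimal Lagrangian value for one instance -/

/-- The mass of a set of inputs. -/
noncomputable def mass {ι : Type} {X : Set (ι → Bool)} [Fintype X] (p : X → ℝ) (L : Set X) : ℝ :=
  ∑ x, L.indicator p x

/-- The expected reward collected on `L`, where `r A o x` is the reward for reaching with input `x`
a leaf labelled `o` that is reached by the inputs in `A`. -/
noncomputable def gain {ι : Type} {X : Set (ι → Bool)} [Fintype X] (p : X → ℝ)
    (r : Set X → Bool → X → ℝ) (D : DTree ι Bool) (L : Set X) : ℝ :=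
  ∑ x, L.indicator (fun x => p x * r (L ∩ {y | D.path y.1 = D.path x.1}) (D.eval x.1) x) x

/-- The expected cost on `L`. -/
noncomputable def massCost {ι : Type} {X : Set (ι → Bool)} [Fintype X] (p : X → ℝ)
    (D : DTree ι Bool) (L : Set X) : ℝ :=
  ∑ x, L.indicator (fun x => p x * D.cost x.1) x

/-- Rewards in `[0, 1]` such that every set of inputs admits a label with average reward at least
`1 / 2`, and every singleton one with full reward. -/
structure IsReward {ι : Type} {X : Set (ι → Bool)} [Fintype X] (p : X → ℝ)
    (r : Set X → Bool → X → ℝ) : Prop where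
  weight_nonneg : ∀ x, 0 ≤ p x
  weight_sum : ∑ x, p x = 1
  nonneg : ∀ L o x, 0 ≤ r L o x
  le_one : ∀ L o x, r L o x ≤ 1
  half_le : ∀ L, ∃ o, mass p L / 2 ≤ gain p r (.leaf o) L
  full_le : ∀ L : Set X, L.Subsingleton → ∃ o, mass p L ≤ gain p r (.leaf o) L

section Single

variable {ι : Type} {X : Set (ι → Bool)} [Fintype X] {p : X → ℝ} {r : Set X → Bool → X → ℝ}

theorem mass_split (j : ι) (L : Set X) :
    mass p L = mass p (L ∩ {y | y.1 j = false}) + mass p (L ∩ {y | y.1 j = true}) := by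
  simp only [mass, ← Finset.sum_add_distrib]
  refine Finset.sum_congr rfl fun x _ => ?_
  by_cases hx : x ∈ L <;> cases hj : x.1 j <;> simp [Set.indicator, hx, hj]

theorem gain_query (j : ι) (t₀ t₁ : DTree ι Bool) (L : Set X) :
    gain p r (.query j t₀ t₁) L =
      gain p r t₀ (L ∩ {y | y.1 j = false}) + gain p r t₁ (L ∩ {y | y.1 j = true}) := by
  simp only [gain, ← Finset.sum_add_distrib]
  refine Finset.sum_congr rfl fun x _ => ?_
  simp only [DTree.query_path_eq_iff, DTree.eval]
  by_cases hx : x ∈ L <;> cases hj : x.1 j <;>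
    simp [Set.indicator, hx, hj, Set.inter_assoc, Set.ofPred_and]

theorem massCost_query (j : ι) (t₀ t₁ : DTree ι Bool) (L : Set X) :
    massCost p (.query j t₀ t₁) L = mass p L +
      (massCost p t₀ (L ∩ {y | y.1 j = false}) + massCost p t₁ (L ∩ {y | y.1 j = true})) := by
  simp only [massCost, mass, ← Finset.sum_add_distrib]
  refine Finset.sum_congr rfl fun x _ => ?_
  by_cases hx : x ∈ L <;> cases hj : x.1 j <;>
    simp [Set.indicator, hx, hj, DTree.cost] <;> ring

theorem massCost_leaf (o : Bool) (L : Set X) : massCost p (.leaf o) L = 0 := by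
  simp [massCost, DTree.cost]

namespace IsReward

variable (h : IsReward p r)
include h

theorem mass_nonneg (L : Set X) : 0 ≤ mass p L :=
  Finset.sum_nonneg fun x _ => Set.indicator_nonneg (fun x _ => h.weight_nonneg x) x

theorem gain_nonneg (D : DTree ι Bool) (L : Set X) : 0 ≤ gain p r D L :=
  Finset.sum_nonneg fun x _ => Set.indicator_nonneg
    (fun x _ => mul_nonneg (h.weight_nonneg x) (h.nonneg _ _ _)) x

theorem gain_le_mass (D : DTree ι Bool) (L : Set X) : gain p r D L ≤ mass p L :=
  Finset.sum_le_sum fun x _ => Set.indicator_le_indicator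
    (mul_le_of_le_one_right (h.weight_nonneg x) (h.le_one _ _ _))

theorem massCost_nonneg (D : DTree ι Bool) (L : Set X) : 0 ≤ massCost p D L :=
  Finset.sum_nonneg fun x _ => Set.indicator_nonneg
    (fun x _ => mul_nonneg (h.weight_nonneg x) (Nat.cast_nonneg _)) x

theorem mass_univ : mass p Set.univ = 1 := by
  simp [mass, h.weight_sum]

end IsReward

/-- The optimal value of the expected reward minus `l / 2` times the expected cost. -/
noncomputable def optValue (p : X → ℝ) (r : Set X → Bool → X → ℝ) (l : ℝ) (L : Set X) : ℝ :=
  ⨆ D : DTree ι Bool, (gain p r D L - l / 2 * massCost p D L)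

namespace IsReward

variable (h : IsReward p r) {l : ℝ} (hl : 0 ≤ l)
include h hl

theorem bddAbove_value (L : Set X) :
    BddAbove (Set.range fun D : DTree ι Bool => gain p r D L - l / 2 * massCost p D L) := by
  refine ⟨mass p L, ?_⟩
  rintro _ ⟨D, rfl⟩
  have := mul_nonneg (half_pos one_pos).le (mul_nonneg hl (h.massCost_nonneg D L))
  have := h.gain_le_mass D L
  dsimp only
  linarith

theorem le_optValue (D : DTree ι Bool) (L : Set X) :
    gain p r D L - l / 2 * massCost p D L ≤ optValue p r l L :=
  le_ciSup (h.bddAbove_value hl L) D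

theorem gain_leaf_le_optValue (o : Bool) (L : Set X) :
    gain p r (.leaf o) L ≤ optValue p r l L := by
  simpa [massCost_leaf] using h.le_optValue hl (.leaf o) L

theorem half_mass_le_optValue (L : Set X) : mass p L / 2 ≤ optValue p r l L := by
  obtain ⟨o, ho⟩ := h.half_le L
  exact ho.trans (h.gain_leaf_le_optValue hl o L)

theorem optValue_nonneg (L : Set X) : 0 ≤ optValue p r l L :=
  (half_pos one_pos |>.le |> mul_nonneg (h.mass_nonneg L)).trans
    (by simpa [div_eq_mul_inv] using h.half_mass_le_optValue hl L)

/-- Querying `j` and continuing near-optimally on both halves is one strategy on `L`, so the halves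
gain at most the price `l / 2 * mass p L` of the query. By the guessing bound this is at most `l *
optValue p r l L`: the loss is multiplicative, which is what makes it compatible with products. -/
theorem optValue_split_le (j : ι) (L : Set X) :
    optValue p r l (L ∩ {y | y.1 j = false}) + optValue p r l (L ∩ {y | y.1 j = true}) ≤
      Real.exp l * optValue p r l L := by
  have : Nonempty (DTree ι Bool) := ⟨.leaf true⟩
  have key : optValue p r l (L ∩ {y | y.1 j = false}) + optValue p r l (L ∩ {y | y.1 j = true}) ≤
      optValue p r l L + l / 2 * mass p L := by
    rw [← le_sub_iff_add_le]
    refine ciSup_le fun t₀ => ?_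
    rw [le_sub_comm]
    refine ciSup_le fun t₁ => ?_
    have := h.le_optValue hl (.query j t₀ t₁) L
    rw [gain_query, massCost_query] at this
    linarith
  have h1 := mul_le_mul_of_nonneg_left (h.half_mass_le_optValue hl L) hl
  have h2 := mul_le_mul_of_nonneg_right (Real.add_one_le_exp l) (h.optValue_nonneg hl L)
  linarith

omit hl in
-- Querying every bit isolates single inputs, where `full_le` applies. The induction is over the set
-- of bits not yet fixed on `L`.
theorem exists_full_gain [Finite ι] : ∃ D : DTree ι Bool, 1 ≤ gain p r D Set.univ := by
  classical
  have := Fintype.ofFinite ι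
  suffices H : ∀ (s : Finset ι) (L : Set X),
      (∀ x ∈ L, ∀ y ∈ L, ∀ j ∉ s, x.1 j = y.1 j) → ∃ D : DTree ι Bool, mass p L ≤ gain p r D L by
    rw [← h.mass_univ]
    exact H Finset.univ Set.univ fun x _ y _ j hj => absurd (Finset.mem_univ j) hj
  intro s
  induction s using Finset.induction_on with
  | empty =>
    intro L hL
    obtain ⟨o, ho⟩ := h.full_le L fun x hx y hy =>
      Subtype.ext (funext fun j => hL x hx y hy j (Finset.notMem_empty j))
    exact ⟨_, ho⟩
  | insert j s hj ih =>
    intro L hL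
    have hb : ∀ b, ∃ D : DTree ι Bool,
        mass p (L ∩ {y | y.1 j = b}) ≤ gain p r D (L ∩ {y | y.1 j = b}) := by
      intro b
      refine ih _ fun x hx y hy k hk => ?_
      by_cases hkj : k = j
      · subst hkj
        exact hx.2.trans hy.2.symm
      · exact hL x hx.1 y hy.1 k (by simp [hkj, hk])
    obtain ⟨t₀, h₀⟩ := hb false
    obtain ⟨t₁, h₁⟩ := hb true
    refine ⟨.query j t₀ t₁, ?_⟩
    rw [gain_query, mass_split j]
    exact add_le_add h₀ h₁

end IsReward

end Single

/-! ### From `n` instances back to one -/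

section Product

variable {m n : ℕ} {X : Set (Fin m → Bool)} [Fintype X] {p : X → ℝ} {r : Set X → Bool → X → ℝ}

/-- The expected product reward of a tree for `n` independent inputs in the product set `∏ L i`,
discounted exponentially in the cost. -/
noncomputable def prodGain (p : X → ℝ) (r : Set X → Bool → X → ℝ) (l : ℝ)
    (D : DTree (Fin n × Fin m) (Fin n → Bool)) (L : Fin n → Set X) : ℝ :=
  ∑ z : Fin n → X, (Set.univ.pi L).indicator (fun z => (∏ i, p (z i)) *
    (Real.exp (-(l * D.cost (joinInputs z))) *
      ∏ i, r (L i ∩ leafFactor D z i) (D.eval (joinInputs z) i) (z i))) z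

theorem prodGain_leaf (l : ℝ) (o : Fin n → Bool) (L : Fin n → Set X) :
    prodGain p r l (.leaf o) L = ∏ i, gain p r (.leaf (o i)) (L i) := by
  classical
  simp only [gain, prodGain]
  rw [Finset.prod_univ_sum, Fintype.piFinset_univ]
  refine Finset.sum_congr rfl fun z _ => ?_
  by_cases hz : z ∈ Set.univ.pi L
  · rw [Set.indicator_of_mem hz]
    simp only [DTree.cost, DTree.eval, leafFactor, DTree.path, Nat.cast_zero, mul_zero, neg_zero,
      Real.exp_zero, one_mul, ← Finset.prod_mul_distrib]
    exact Finset.prod_congr rfl fun i _ => by rw [Set.indicator_of_mem (hz i trivial)]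
  · rw [Set.indicator_of_notMem hz]
    simp only [Set.mem_univ_pi, not_forall] at hz
    obtain ⟨i, hi⟩ := hz
    rw [Finset.prod_eq_zero (Finset.mem_univ i)]
    rw [Set.indicator_of_notMem hi]

omit [Fintype X] in
-- A query to instance `i` restricts only the `i`-th factor of the product set, so the recursion
-- never leaves product sets.
theorem leafFactor_query (i : Fin n) (j : Fin m) (t₀ t₁ : DTree (Fin n × Fin m) (Fin n → Bool))
    (z : Fin n → X) (L : Fin n → Set X) (k : Fin n) :
    L k ∩ leafFactor (.query (i, j) t₀ t₁) z k =
      Function.update L i (L i ∩ {y | y.1 j = (z i).1 j}) k ∩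
        leafFactor (if (z i).1 j then t₁ else t₀) z k := by
  ext y
  simp only [leafFactor, Set.mem_inter_iff, Set.mem_ofPred_eq, DTree.query_path_eq_iff]
  by_cases hk : k = i
  · subst hk
    cases hb : (z k).1 j <;> simp [joinInputs, hb, and_assoc]
  · have hk' : ¬ i = k := fun e => hk e.symm
    cases hb : (z i).1 j <;> simp [joinInputs, hb, hk, hk']

theorem prodGain_query (l : ℝ) (i : Fin n) (j : Fin m)
    (t₀ t₁ : DTree (Fin n × Fin m) (Fin n → Bool)) (L : Fin n → Set X) :
    prodGain p r l (.query (i, j) t₀ t₁) L = Real.exp (-l) *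
      (prodGain p r l t₀ (Function.update L i (L i ∩ {y | y.1 j = false})) +
        prodGain p r l t₁ (Function.update L i (L i ∩ {y | y.1 j = true}))) := by
  classical
  simp only [prodGain, ← Finset.sum_add_distrib, Finset.mul_sum, leafFactor_query]
  refine Finset.sum_congr rfl fun z _ => ?_
  have hmem : ∀ b, z ∈ Set.univ.pi (Function.update L i (L i ∩ {y | y.1 j = b})) ↔
      z ∈ Set.univ.pi L ∧ (z i).1 j = b := by
    intro b
    simp only [Set.mem_univ_pi]
    constructor
    · intro hz
      have hi := hz i
      simp only [Function.update_self] at hi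
      refine ⟨fun k => ?_, hi.2⟩
      by_cases hk : k = i
      · subst hk; exact hi.1
      · simpa [hk] using hz k
    · rintro ⟨hz, hb⟩ k
      by_cases hk : k = i
      · subst hk; simpa using ⟨hz k, hb⟩
      · simpa [hk] using hz k
  have hexp : ∀ c : ℕ, Real.exp (-(l * ((1 + c : ℕ) : ℝ))) =
      Real.exp (-l) * Real.exp (-(l * (c : ℝ))) := by
    intro c
    rw [← Real.exp_add]
    congr 1
    push_cast
    ring
  have hjoin : joinInputs z (i, j) = (z i).1 j := rfl
  by_cases hz : z ∈ Set.univ.pi L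
  · rw [Set.indicator_of_mem hz]
    cases hb : (z i).1 j
    · rw [Set.indicator_of_mem ((hmem false).2 ⟨hz, hb⟩),
        Set.indicator_of_notMem (fun hc => by simpa [hb] using ((hmem true).1 hc).2)]
      simp only [DTree.cost, DTree.eval, hjoin, hb, Bool.false_eq_true, if_false, hexp]
      ring
    · rw [Set.indicator_of_mem ((hmem true).2 ⟨hz, hb⟩),
        Set.indicator_of_notMem (fun hc => by simpa [hb] using ((hmem false).1 hc).2)]
      simp only [DTree.cost, DTree.eval, hjoin, hb, if_true, hexp]
      ring
  · rw [Set.indicator_of_notMem hz, Set.indicator_of_notMem fun hc => hz ((hmem _).1 hc).1,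
      Set.indicator_of_notMem fun hc => hz ((hmem _).1 hc).1]
    simp

namespace IsReward

variable (h : IsReward p r)
include h

/-- At a query only factor `i` changes; it grows by at most `exp l` after summing both branches,
which cancels the discount `exp (-l)` exactly. -/
theorem prodGain_le_prod_optValue {l : ℝ} (hl : 0 ≤ l)
    (D : DTree (Fin n × Fin m) (Fin n → Bool)) (L : Fin n → Set X) :
    prodGain p r l D L ≤ ∏ i, optValue p r l (L i) := by
  classical
  induction D generalizing L with
  | leaf o =>
    rw [prodGain_leaf]
    exact Finset.prod_le_prod (fun i _ => h.gain_nonneg _ _)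
      fun i _ => h.gain_leaf_le_optValue hl _ _
  | query ij t₀ t₁ ih₀ ih₁ =>
    obtain ⟨i, j⟩ := ij
    rw [prodGain_query]
    have hupd : ∀ A : Set X, ∏ k, optValue p r l (Function.update L i A k) =
        optValue p r l A * ∏ k ∈ Finset.univ \ {i}, optValue p r l (L k) := by
      intro A
      rw [← Finset.prod_update_of_mem (Finset.mem_univ i)]
      exact Finset.prod_congr rfl fun k _ =>
        Function.apply_update (fun _ => optValue p r l) L i A k
    have hself : ∏ k, optValue p r l (L k) =
        optValue p r l (L i) * ∏ k ∈ Finset.univ \ {i}, optValue p r l (L k) := by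
      rw [← hupd, Function.update_eq_self]
    calc _ ≤ Real.exp (-l) *
          ((optValue p r l (L i ∩ {y | y.1 j = false}) +
            optValue p r l (L i ∩ {y | y.1 j = true})) *
              ∏ k ∈ Finset.univ \ {i}, optValue p r l (L k)) := by
          rw [add_mul, ← hupd, ← hupd]
          exact mul_le_mul_of_nonneg_left (add_le_add (ih₀ _) (ih₁ _)) (Real.exp_nonneg _)
      _ ≤ Real.exp (-l) * ((Real.exp l * optValue p r l (L i)) *
              ∏ k ∈ Finset.univ \ {i}, optValue p r l (L k)) := by
          refine mul_le_mul_of_nonneg_left (mul_le_mul_of_nonneg_right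
            (h.optValue_split_le hl j _) ?_) (Real.exp_nonneg _)
          exact Finset.prod_nonneg fun k _ => h.optValue_nonneg hl _
      _ = _ := by
          rw [hself, ← mul_assoc, ← mul_assoc, ← Real.exp_add]
          simp

theorem sub_le_optValue_of_prodGain (hn : 1 ≤ n) {γ B l : ℝ} (hγ0 : 0 ≤ γ) (hγ1 : γ ≤ 1)
    (hB : 0 ≤ B) (hl : 0 ≤ l) (R : RandAlg (Fin n × Fin m) (Fin n → Bool))
    (hcost : ∀ D ∈ R.support, ∀ z : Fin n → X, (D.cost (joinInputs z) : ℝ) ≤ B)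
    (hR : ENNReal.ofReal (γ ^ n) ≤
      ∑' D, R D * ENNReal.ofReal (prodGain p r 0 D fun _ => Set.univ)) :
    γ - l * (B / n) ≤ optValue p r l Set.univ := by
  have hn0 : (n : ℝ) ≠ 0 := by positivity
  set V := optValue p r l Set.univ with hV
  have hV0 : 0 ≤ V := h.optValue_nonneg hl _
  have hD : ∀ D ∈ R.support,
      prodGain p r 0 D (fun _ => Set.univ) ≤ Real.exp (l * B) * V ^ n := by
    intro D hD
    have h1 : prodGain p r 0 D (fun _ => Set.univ) ≤
        Real.exp (l * B) * prodGain p r l D fun _ => Set.univ := by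
      rw [prodGain, prodGain, Finset.mul_sum]
      refine Finset.sum_le_sum fun z _ => ?_
      rw [Set.indicator_of_mem (by simp), Set.indicator_of_mem (by simp)]
      rw [mul_left_comm (Real.exp (l * B))]
      refine mul_le_mul_of_nonneg_left ?_ (Finset.prod_nonneg fun i _ => h.weight_nonneg (z i))
      rw [← mul_assoc, ← Real.exp_add]
      refine mul_le_mul_of_nonneg_right ?_ (Finset.prod_nonneg fun i _ => h.nonneg _ _ _)
      refine Real.exp_le_exp.2 ?_
      have := mul_le_mul_of_nonneg_left (hcost D hD z) hl
      linarith
    have h2 := h.prodGain_le_prod_optValue hl D fun _ => Set.univ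
    rw [Finset.prod_const, Finset.card_univ, Fintype.card_fin] at h2
    exact h1.trans (mul_le_mul_of_nonneg_left h2 (Real.exp_nonneg _))
  have hpow : γ ^ n ≤ Real.exp (l * B) * V ^ n := by
    rw [← ENNReal.ofReal_le_ofReal_iff (by positivity)]
    refine hR.trans ?_
    rw [← PMF.tsum_const_mul R (ENNReal.ofReal (Real.exp (l * B) * V ^ n))]
    refine ENNReal.tsum_le_tsum fun D => ?_
    by_cases hDs : D ∈ R.support
    · gcongr
      exact hD D hDs
    · rw [PMF.mem_support_iff, not_not] at hDs
      simp [hDs]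
  have hroot : γ ≤ Real.exp (l * (B / n)) * V := by
    refine le_of_pow_le_pow_left₀ (Nat.one_le_iff_ne_zero.1 hn) (by positivity) ?_
    rwa [mul_pow, ← Real.exp_nat_mul, mul_left_comm, mul_div_cancel₀ _ hn0]
  have hb : 0 ≤ l * (B / n) := by positivity
  -- `exp (-t) ≥ 1 - t` together with `γ ≤ 1` linearises the bound to `γ - t`.
  have h3 := mul_le_mul_of_nonneg_left (Real.add_one_le_exp (-(l * (B / n)))) hγ0
  have h4 := mul_le_mul_of_nonneg_left hroot (Real.exp_nonneg (-(l * (B / n))))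
  rw [← mul_assoc, ← Real.exp_add, neg_add_cancel, Real.exp_zero, one_mul] at h4
  nlinarith

/-- Minimax with the two payoffs reward and minus cost: weights `w` correspond to the multiplier `l
= 2 * w false / w true`, and the `2` undoes the price `l / 2`. The reward obtained falls short by
`η`; a small admixture of the full-reward tree `F` repairs this. -/
theorem exists_randAlg_of_forall_optValue {γ b ε : ℝ} (hγ1 : γ < 1) (hb : 0 ≤ b) (hε : 0 < ε)
    (hopt : ∀ l, 0 ≤ l → γ - l * b ≤ optValue p r l Set.univ) :
    ∃ R : RandAlg (Fin m) Bool,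
      ENNReal.ofReal γ ≤ ∑' D, R D * ENNReal.ofReal (gain p r D Set.univ) ∧
      ∑' D, R D * ENNReal.ofReal (massCost p D Set.univ) ≤ ENNReal.ofReal (2 * b + ε) := by
  obtain ⟨F, hF⟩ := h.exists_full_gain
  have : Nonempty (DTree (Fin m) Bool) := ⟨F⟩
  set K := massCost p F Set.univ with hK
  have hK0 : 0 ≤ K := h.massCost_nonneg _ _
  set g : DTree (Fin m) Bool → Bool → ℝ := fun D c =>
    if c then gain p r D Set.univ else -massCost p D Set.univ with hg
  have hγ' : 0 < 1 - γ := by linarith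
  obtain ⟨η, hη, hηε⟩ : ∃ η : ℝ, 0 < η ∧ η * (1 + K / (1 - γ)) ≤ ε :=
    ⟨ε / (1 + K / (1 - γ)), by positivity, by rw [div_mul_cancel₀ _ (by positivity)]⟩
  obtain ⟨s, hs, hlt⟩ := exists_mem_convexHull_forall_lt g
      (fun c => if c then γ - η / 2 else -(2 * b)) (half_pos hη) (by
    intro w hw0 hw1
    rw [Fintype.sum_bool] at hw1
    simp only [Fintype.sum_bool, hg, if_true, Bool.false_eq_true, if_false]
    -- With all weight on the cost, a leaf is optimal.
    rcases (hw0 true).eq_or_lt with hw | hw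
    · refine ⟨.leaf true, ?_⟩
      rw [← hw, massCost_leaf]
      have := mul_nonneg (hw0 false) hb
      linarith
    · have hl : 0 ≤ 2 * w false / w true := by have := hw0 false; positivity
      have := hopt _ hl
      obtain ⟨D, hD⟩ := exists_lt_of_lt_ciSup (show γ - 2 * w false / w true * b - η / 2 <
        optValue p r (2 * w false / w true) Set.univ by linarith)
      refine ⟨D, ?_⟩
      have h1 := mul_le_mul_of_nonneg_left hD.le hw.le
      have e1 : w true * (γ - 2 * w false / w true * b - η / 2) =
        w true * (γ - η / 2) + w false * -(2 * b) := by field_simp; ring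
      have e2 : w true * (gain p r D Set.univ -
          2 * w false / w true / 2 * massCost p D Set.univ) =
        w true * gain p r D Set.univ + w false * -massCost p D Set.univ := by
        field_simp; ring
      linarith)
  have h1 := hlt true
  have h2 := hlt false
  simp only [if_true, Bool.false_eq_true, if_false] at h1 h2
  -- `q` solves `(1 - q) * (γ - η) + q = γ`. The extra cost `q * K` is at most `η * (K / (1 - γ))`,
  -- which the choice of `η` keeps below `ε`.
  set q := η / (1 - γ + η) with hq
  have hq0 : 0 ≤ q := by positivity
  have hq1 : q ≤ 1 := by rw [hq, div_le_one (by positivity)]; linarith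
  have hqe : q * (1 - γ + η) = η := by rw [hq, div_mul_cancel₀ _ (by positivity)]
  have hqK : q * K ≤ η * (K / (1 - γ)) := by
    have : q ≤ η / (1 - γ) := by rw [hq]; gcongr; linarith
    calc q * K ≤ η / (1 - γ) * K := by gcongr
      _ = _ := by ring
  have hmix := (convex_convexHull ℝ (Set.range g)) hs (subset_convexHull ℝ _ ⟨F, rfl⟩)
    (sub_nonneg.2 hq1) hq0 (by ring)
  obtain ⟨R, E, hE, -, -, hER⟩ := exists_pmf_of_mem_convexHull g hmix
  refine ⟨R, ?_, ?_⟩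
  · rw [hER _ fun D => h.gain_nonneg _ _]
    have e := hE true
    simp only [hg, if_true, Pi.add_apply, Pi.smul_apply, smul_eq_mul] at e
    rw [e]
    refine ENNReal.ofReal_le_ofReal ?_
    nlinarith
  · rw [hER _ fun D => h.massCost_nonneg _ _]
    have e := hE false
    simp only [hg, Bool.false_eq_true, if_false, Pi.add_apply, Pi.smul_apply, smul_eq_mul] at e
    have e' : (fun D => -massCost p D Set.univ) = -(fun D => massCost p D Set.univ) := rfl
    rw [e', map_neg] at e
    refine ENNReal.ofReal_le_ofReal ?_
    have h5 : (1 - q) * -s false ≤ 2 * b + η := by nlinarith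
    rw [← hK] at e
    nlinarith

end IsReward

end Product

/-! ### Success and score as rewards; the lower bounds -/

section Reductions

variable {m n : ℕ} {X : Set (Fin m → Bool)} [Fintype X]

/-- Here `d` is any lower bound on the expected cost of single-instance algorithms with reward `γ`;
both distributional complexities are used in this role. -/
theorem IsReward.half_mul_le_worstCost {p : X → ℝ} {r : Set X → Bool → X → ℝ}
    (h : IsReward p r) (hn : 1 ≤ n) {γ : ℝ} (hγ0 : 0 ≤ γ) (hγ1 : γ < 1)
    (R : RandAlg (Fin n × Fin m) (Fin n → Bool))
    (hR : ENNReal.ofReal (γ ^ n) ≤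
      ∑' D, R D * ENNReal.ofReal (prodGain p r 0 D fun _ => Set.univ))
    {d : ℝ≥0∞} (hd : ∀ R' : RandAlg (Fin m) Bool,
      ENNReal.ofReal γ ≤ ∑' D, R' D * ENNReal.ofReal (gain p r D Set.univ) →
      d ≤ ∑' D, R' D * ENNReal.ofReal (massCost p D Set.univ)) :
    ENNReal.ofReal (1 / 2) * ((n : ℝ≥0∞) * d) ≤ worstCost (powDomain X n) R := by
  by_cases htop : worstCost (powDomain X n) R = ⊤
  · rw [htop]; exact le_top
  set B := (worstCost (powDomain X n) R).toReal with hB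
  have hB0 : 0 ≤ B := ENNReal.toReal_nonneg
  have hcost : ∀ D ∈ R.support, ∀ z : Fin n → X, (D.cost (joinInputs z) : ℝ) ≤ B := by
    intro D hD z
    have hz : joinInputs z ∈ powDomain X n := fun i => (z i).2
    have : (D.cost (joinInputs z) : ℝ≥0∞) ≤ worstCost (powDomain X n) R :=
      le_iSup₂_of_le (joinInputs z) hz
        (le_iSup₂ (f := fun (D : DTree (Fin n × Fin m) (Fin n → Bool)) (_ : D ∈ R.support) =>
          (D.cost (joinInputs z) : ℝ≥0∞)) D hD)
    simpa using ENNReal.toReal_mono htop this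
  have hdle : d ≤ ENNReal.ofReal (2 * (B / n)) := by
    refine ENNReal.le_of_forall_pos_le_add fun ε hε _ => ?_
    obtain ⟨R', h1, h2⟩ := h.exists_randAlg_of_forall_optValue (b := B / n) (ε := ε) hγ1
      (by positivity) (by exact_mod_cast hε)
      fun l hl => h.sub_le_optValue_of_prodGain hn hγ0 hγ1.le hB0 hl R hcost hR
    refine ((hd R' h1).trans h2).trans ?_
    exact ENNReal.ofReal_add_le.trans_eq (by rw [ENNReal.ofReal_coe_nnreal])
  calc ENNReal.ofReal (1 / 2) * ((n : ℝ≥0∞) * d)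
      ≤ ENNReal.ofReal (1 / 2) * ((n : ℝ≥0∞) * ENNReal.ofReal (2 * (B / n))) := by gcongr
    _ = ENNReal.ofReal (1 / 2 * (n * (2 * (B / n)))) := by
        rw [ENNReal.ofReal_mul (p := 1 / 2) (by norm_num),
          ENNReal.ofReal_mul (p := (n : ℝ)) (Nat.cast_nonneg _), ENNReal.ofReal_natCast]
    _ = ENNReal.ofReal B := by
        congr 1
        field_simp
    _ = worstCost (powDomain X n) R := ENNReal.ofReal_toReal htop

theorem sum_toReal_pmf (μ : PMF X) : ∑ x, (μ x).toReal = 1 := by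
  rw [← ENNReal.toReal_sum fun x _ => μ.apply_ne_top x, ← tsum_fintype (L := .unconditional _),
    μ.tsum_coe, ENNReal.toReal_one]

theorem ofReal_sum_toReal_mul (μ : PMF X) {h : X → ℝ} (hh : ∀ x, 0 ≤ h x) :
    ENNReal.ofReal (∑ x, (μ x).toReal * h x) = ∑' x, μ x * ENNReal.ofReal (h x) := by
  rw [tsum_fintype, ENNReal.ofReal_sum_of_nonneg fun x _ =>
    mul_nonneg ENNReal.toReal_nonneg (hh x)]
  refine Finset.sum_congr rfl fun x _ => ?_
  rw [ENNReal.ofReal_mul ENNReal.toReal_nonneg, ENNReal.ofReal_toReal (μ.apply_ne_top x)]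

theorem avgCost_eq_tsum (μ : PMF X) (R : RandAlg (Fin m) Bool) :
    avgCost μ R =
      ∑' D, R D * ENNReal.ofReal (massCost (fun x => (μ x).toReal) D Set.univ) := by
  simp only [avgCost, massCost, Set.indicator_univ]
  simp only [ofReal_sum_toReal_mul μ (fun x => Nat.cast_nonneg _), ← ENNReal.tsum_mul_left,
    ENNReal.ofReal_natCast]
  rw [ENNReal.tsum_comm]
  exact tsum_congr fun D => tsum_congr fun x => mul_left_comm _ _ _

theorem prodGain_zero_univ (μ : PMF X) {r : Set X → Bool → X → ℝ} (hr : ∀ L o x, 0 ≤ r L o x)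
    (D : DTree (Fin n × Fin m) (Fin n → Bool)) :
    ENNReal.ofReal (prodGain (fun x => (μ x).toReal) r 0 D fun _ => Set.univ) =
      ∑' z : Fin n → X, (∏ i, μ (z i)) *
        ∏ i, ENNReal.ofReal (r (leafFactor D z i) (D.eval (joinInputs z) i) (z i)) := by
  have hp : ∀ z : Fin n → X, 0 ≤ ∏ i, (μ (z i)).toReal := fun z =>
    Finset.prod_nonneg fun i _ => ENNReal.toReal_nonneg
  simp only [prodGain, Set.pi_univ, Set.indicator_univ, zero_mul, neg_zero, Real.exp_zero,
    one_mul, Set.univ_inter]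
  rw [ENNReal.ofReal_sum_of_nonneg fun z _ =>
    mul_nonneg (hp z) (Finset.prod_nonneg fun i _ => hr _ _ _), tsum_fintype]
  refine Finset.sum_congr rfl fun z _ => ?_
  rw [ENNReal.ofReal_mul (hp z), ENNReal.ofReal_prod_of_nonneg fun i _ => ENNReal.toReal_nonneg,
    ENNReal.ofReal_prod_of_nonneg fun i _ => hr _ _ _]
  congr 1
  exact Finset.prod_congr rfl fun i _ => ENNReal.ofReal_toReal (μ.apply_ne_top _)

theorem isReward_success (f : X → Bool) (μ : PMF X) :
    IsReward (fun x => (μ x).toReal) (fun _ o x => if f x = o then 1 else 0) where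
  weight_nonneg _ := ENNReal.toReal_nonneg
  weight_sum := sum_toReal_pmf μ
  nonneg L o x := by split <;> norm_num
  le_one L o x := by split <;> norm_num
  half_le L := by
    -- The gains of the two constant labels add up to the mass.
    by_contra! hcon
    have h1 := hcon true
    have h2 := hcon false
    have : mass (fun x => (μ x).toReal) L =
        gain (fun x => (μ x).toReal) (fun _ o x => if f x = o then 1 else 0) (.leaf true) L +
        gain (fun x => (μ x).toReal) (fun _ o x => if f x = o then 1 else 0) (.leaf false) L := by
      simp only [mass, gain, ← Finset.sum_add_distrib, DTree.eval]
      refine Finset.sum_congr rfl fun x _ => ?_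
      by_cases hx : x ∈ L <;> cases hf : f x <;> simp [hx, hf]
    linarith
  full_le L hL := by
    rcases L.eq_empty_or_nonempty with rfl | ⟨y, hy⟩
    · exact ⟨true, by simp [mass, gain]⟩
    · refine ⟨f y, Finset.sum_le_sum fun x _ => ?_⟩
      by_cases hx : x ∈ L
      · rw [Set.indicator_of_mem hx, Set.indicator_of_mem hx]
        simp [hL hx hy, DTree.eval]
      · simp [hx]

theorem isReward_score {φ : ℝ → ℝ} (hφ : IsScoreFunction φ) (f : X → Bool) (μ : PMF X) :
    IsReward (fun x => (μ x).toReal) (fun L _ _ => setScore φ f μ L) := by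
  have hb : ∀ L, setScore φ f μ L ∈ Set.Icc (1 / 2 : ℝ) 1 := by
    intro L
    refine hφ.bounded _ ⟨ENNReal.toReal_nonneg, ?_⟩
    refine ENNReal.toReal_le_of_le_ofReal zero_le_one ?_
    rw [ENNReal.ofReal_one]
    refine ENNReal.div_le_of_le_mul ?_
    rw [one_mul]
    exact MeasureTheory.measure_mono Set.inter_subset_left
  refine ⟨fun _ => ENNReal.toReal_nonneg, sum_toReal_pmf μ,
    fun L _ _ => (by norm_num : (0 : ℝ) ≤ 1 / 2).trans (hb L).1, fun L _ _ => (hb L).2, ?_, ?_⟩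
  · refine fun L => ⟨true, ?_⟩
    rw [mass, gain, Finset.sum_div]
    refine Finset.sum_le_sum fun x _ => ?_
    by_cases hx : x ∈ L
    · rw [Set.indicator_of_mem hx, Set.indicator_of_mem hx, div_eq_mul_one_div]
      exact mul_le_mul_of_nonneg_left (hb _).1 ENNReal.toReal_nonneg
    · simp [hx]
  · refine fun L hL => ⟨true, Finset.sum_le_sum fun x _ => ?_⟩
    by_cases hx : x ∈ L
    · rw [Set.indicator_of_mem hx, Set.indicator_of_mem hx]
      refine le_mul_of_one_le_right ENNReal.toReal_nonneg (le_of_eq ?_)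
      have hL' : L = {x} := hL.eq_singleton_of_mem hx
      have h1 : L ∩ {y : X | (DTree.leaf true : DTree (Fin m) Bool).path y.1 =
          (DTree.leaf true : DTree (Fin m) Bool).path x.1} = {x} := by
        rw [hL']; simp
      dsimp only
      rw [h1]
      unfold setScore
      by_cases hf : f x = true
      · rw [Set.inter_eq_left.2 (by simpa using hf)]
        -- On a null singleton the ratio is `0 / 0 = 0`, and `φ 0 = 1` still gives full score.
        by_cases h0 : μ.toOuterMeasure {x} = 0
        · rw [h0]; simp [hφ.map_zero]
        · rw [ENNReal.div_self h0 (by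
            rw [PMF.toOuterMeasure_apply_singleton]; exact μ.apply_ne_top x)]
          simp [hφ.map_one]
      · have : ({x} : Set X) ∩ f ⁻¹' {true} = ∅ := by
          rw [Set.singleton_inter_eq_empty]
          exact hf
        rw [this]
        simp [hφ.map_zero]
    · simp [hx]

theorem tsum_prod_pmf (μ : PMF X) : ∑' z : Fin n → X, ∏ i, μ (z i) = 1 := by
  classical
  have h : ∑ x, μ x = 1 := by rw [← tsum_fintype (L := .unconditional _), μ.tsum_coe]
  have := Finset.prod_univ_sum (fun _ : Fin n => (Finset.univ : Finset X)) (fun _ x => μ x)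
  rw [Fintype.piFinset_univ, h, Finset.prod_const_one] at this
  rw [tsum_fintype, ← this]

open Classical in
theorem successProb_eq_tsum {ι O : Type} {X : Set (ι → Bool)} (f : X → O) (R : RandAlg ι O)
    (x : X) : successProb f R x = ∑' D, R D * if D.eval x.1 = f x then 1 else 0 :=
  PMF.map_apply_eq_tsum _ _ _

theorem avgSuccess_eq_tsum (f : X → Bool) (μ : PMF X) (R : RandAlg (Fin m) Bool) :
    avgSuccess f μ R = ∑' D, R D * ENNReal.ofReal (gain (fun x => (μ x).toReal)
      (fun _ o x => if f x = o then 1 else 0) D Set.univ) := by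
  simp only [avgSuccess, gain, Set.indicator_univ, successProb_eq_tsum]
  simp only [ofReal_sum_toReal_mul μ (fun x => (isReward_success f μ).nonneg ∅ _ x),
    ← ENNReal.tsum_mul_left]
  rw [ENNReal.tsum_comm]
  refine tsum_congr fun D => tsum_congr fun x => ?_
  rw [mul_left_comm]
  by_cases h : D.eval x.1 = f x
  · simp [h]
  · simp [h, Ne.symm h]

theorem avgScore_eq_tsum {φ : ℝ → ℝ} (hφ : IsScoreFunction φ) (f : X → Bool) (μ : PMF X)
    (R : RandAlg (Fin m) Bool) :
    avgScore φ f μ R = ∑' D, R D * ENNReal.ofReal (gain (fun x => (μ x).toReal)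
      (fun L _ _ => setScore φ f μ L) D Set.univ) := by
  simp only [avgScore, gain, Set.indicator_univ, Set.univ_inter]
  refine tsum_congr fun D => ?_
  rw [ofReal_sum_toReal_mul μ fun x => (isReward_score hφ f μ).nonneg _ true x]

/-- The product of the indicators of correct coordinates is the indicator that the whole output
vector is correct, and a bound on every input survives averaging over `μⁿ`. -/
theorem le_tsum_prodGain_of_le_successProb (f : X → Bool) (μ : PMF X) {s : ℝ≥0∞}
    (R : RandAlg (Fin n × Fin m) (Fin n → Bool))
    (hR : ∀ x, s ≤ successProb (powFun f n) R x) :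
    s ≤ ∑' D, R D * ENNReal.ofReal (prodGain (fun x => (μ x).toReal)
      (fun _ o x => if f x = o then 1 else 0) 0 D fun _ => Set.univ) := by
  simp only [prodGain_zero_univ μ (isReward_success f μ).nonneg, ← ENNReal.tsum_mul_left]
  rw [ENNReal.tsum_comm]
  calc s = ∑' z : Fin n → X, (∏ i, μ (z i)) * s := by
        rw [ENNReal.tsum_mul_right, tsum_prod_pmf, one_mul]
    _ ≤ _ := by
        refine ENNReal.tsum_le_tsum fun z => ?_
        have hz : joinInputs z ∈ powDomain X n := fun i => (z i).2
        refine (mul_le_mul_right (hR ⟨joinInputs z, hz⟩) _).trans_eq ?_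
        rw [successProb_eq_tsum, ← ENNReal.tsum_mul_left]
        refine tsum_congr fun D => ?_
        rw [mul_left_comm]
        congr 2
        by_cases h : D.eval (joinInputs z) = powFun f n ⟨joinInputs z, hz⟩
        · rw [if_pos h]
          symm
          refine Finset.prod_eq_one fun i _ => ?_
          rw [if_pos (by rw [h]; rfl), ENNReal.ofReal_one]
        · rw [if_neg h]
          obtain ⟨i, hi⟩ := Function.ne_iff.1 h
          symm
          refine Finset.prod_eq_zero (Finset.mem_univ i) ?_
          rw [if_neg (fun e => hi (by rw [← e]; rfl)), ENNReal.ofReal_zero]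

theorem half_mul_maxDistR_le_worstR (f : X → Bool) (hn : 1 ≤ n) {γ : ℝ} (hγ0 : 0 ≤ γ)
    (hγ1 : γ < 1) :
    ENNReal.ofReal (1 / 2) * ((n : ℝ≥0∞) * maxDistR f γ) ≤ worstR (powFun f n) (γ ^ n) := by
  refine le_iInf₂ fun R hR => ?_
  simp only [maxDistR, ENNReal.mul_iSup]
  refine iSup_le fun μ => (isReward_success f μ).half_mul_le_worstCost hn hγ0 hγ1 R
    (le_tsum_prodGain_of_le_successProb f μ R hR) fun R' hR' => ?_
  rw [← avgCost_eq_tsum]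
  exact iInf₂_le R' (by rwa [avgSuccess_eq_tsum])

theorem half_mul_maxDistScoreR_le_worstPowScoreR {φ : ℝ → ℝ} (hφ : IsScoreFunction φ)
    (f : X → Bool) (hn : 1 ≤ n) {γ : ℝ} (hγ0 : 0 ≤ γ) (hγ1 : γ < 1) :
    ENNReal.ofReal (1 / 2) * ((n : ℝ≥0∞) * maxDistScoreR φ f γ) ≤
      worstPowScoreR φ f n (γ ^ n) := by
  refine le_iInf₂ fun R hR => ?_
  simp only [maxDistScoreR, ENNReal.mul_iSup]
  refine iSup_le fun μ => (isReward_score hφ f μ).half_mul_le_worstCost hn hγ0 hγ1 R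
    ?_ fun R' hR' => ?_
  · simp only [prodGain_zero_univ μ (isReward_score hφ f μ).nonneg]
    exact hR μ
  · rw [← avgCost_eq_tsum]
    exact iInf₂_le R' (by rwa [avgScore_eq_tsum hφ])

end Reductions

/-! ### Composition of trees and majority of three -/

/-- Expected cost on a fixed input. -/
noncomputable def expCost {ι O : Type} (R : RandAlg ι O) (x : ι → Bool) : ℝ≥0∞ :=
  ∑' D, R D * (D.cost x : ℝ≥0∞)

/-- Run a tree and continue with a tree depending on its output. -/
def DTree.andThen {ι O O' : Type} : DTree ι O → (O → DTree ι O') → DTree ι O'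
  | .leaf o, k => k o
  | .query i t₀ t₁, k => .query i (t₀.andThen k) (t₁.andThen k)

theorem DTree.eval_andThen {ι O O' : Type} (D : DTree ι O) (k : O → DTree ι O') (x : ι → Bool) :
    (D.andThen k).eval x = (k (D.eval x)).eval x := by
  induction D with
  | leaf o => rfl
  | query i t₀ t₁ ih₀ ih₁ => cases h : x i <;> simp [andThen, eval, h, ih₀, ih₁]

theorem DTree.cost_andThen {ι O O' : Type} (D : DTree ι O) (k : O → DTree ι O') (x : ι → Bool) :
    (D.andThen k).cost x = D.cost x + (k (D.eval x)).cost x := by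
  induction D with
  | leaf o => simp [andThen, eval, cost]
  | query i t₀ t₁ ih₀ ih₁ =>
    cases h : x i <;> simp [andThen, eval, cost, h, ih₀, ih₁, add_assoc]

/-- The majority vote of three independent runs. -/
noncomputable def majorityAlg {ι : Type} (R : RandAlg ι Bool) : RandAlg ι Bool :=
  R.bind fun D₁ => R.bind fun D₂ => R.map fun D₃ =>
    D₁.andThen fun a => D₂.andThen fun b => D₃.andThen fun c =>
      .leaf ((a && b) || (a && c) || (b && c))

theorem expCost_majorityAlg {ι : Type} (R : RandAlg ι Bool) (x : ι → Bool) :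
    expCost (majorityAlg R) x = 3 * expCost R x := by
  simp only [expCost, majorityAlg, PMF.tsum_bind_mul, PMF.tsum_map_mul, DTree.cost_andThen,
    DTree.cost, Nat.cast_add, mul_add, ENNReal.tsum_add, PMF.tsum_const_mul, Nat.cast_zero,
    mul_zero, tsum_zero]
  ring

theorem successProb_majorityAlg {ι : Type} {X : Set (ι → Bool)} (f : X → Bool)
    (R : RandAlg ι Bool) (x : X) {s : ℝ} (hs0 : 0 ≤ s)
    (hs : successProb f R x = ENNReal.ofReal s) :
    successProb f (majorityAlg R) x = ENNReal.ofReal (3 * s ^ 2 - 2 * s ^ 3) := by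
  classical
  set q := R.map fun D => D.eval x.1 with hq
  have hsum : q (f x) + q (!f x) = 1 := by
    rw [← q.tsum_coe, tsum_fintype, Fintype.sum_bool]
    cases f x
    · exact add_comm _ _
    · rfl
  have hqs : q (f x) = ENNReal.ofReal s := hs
  have hs1 : s ≤ 1 := by
    rw [← ENNReal.ofReal_le_ofReal_iff zero_le_one, ← hqs, ENNReal.ofReal_one]
    exact q.coe_le_one _
  have hqr : q (!f x) = ENNReal.ofReal (1 - s) := by
    rw [ENNReal.ofReal_sub _ hs0, ← hqs, ENNReal.ofReal_one, ← hsum,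
      ENNReal.add_sub_cancel_left (q.apply_ne_top _)]
  -- Only the law `q` of the output bit matters, so the three runs can be integrated out one by one.
  have hF : ∀ F : Bool → ℝ≥0∞, ∑' D, R D * F (D.eval x.1) =
      q (f x) * F (f x) + q (!f x) * F (!f x) := by
    intro F
    rw [← PMF.tsum_map_mul R (fun D => D.eval x.1) F, ← hq, tsum_fintype, Fintype.sum_bool]
    cases f x
    · exact add_comm _ _
    · rfl
  rw [successProb_eq_tsum]
  simp only [majorityAlg, PMF.tsum_bind_mul, PMF.tsum_map_mul, DTree.eval_andThen, DTree.eval]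
  rw [hF fun a => ∑' D₂, R D₂ * ∑' D₃, R D₃ *
    if (a && D₂.eval x.1 || a && D₃.eval x.1 || D₂.eval x.1 && D₃.eval x.1) = f x then 1 else 0]
  rw [hF fun b => ∑' D₃, R D₃ *
    if (f x && b || f x && D₃.eval x.1 || b && D₃.eval x.1) = f x then 1 else 0]
  rw [hF fun b => ∑' D₃, R D₃ *
    if (!f x && b || !f x && D₃.eval x.1 || b && D₃.eval x.1) = f x then 1 else 0]
  rw [hF fun c => if (f x && f x || f x && c || f x && c) = f x then 1 else 0]
  rw [hF fun c => if (f x && !f x || f x && c || !f x && c) = f x then 1 else 0]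
  rw [hF fun c => if (!f x && f x || !f x && c || f x && c) = f x then 1 else 0]
  rw [hF fun c => if (!f x && !f x || !f x && c || !f x && c) = f x then 1 else 0]
  rw [hqs, hqr]
  have hr0 : 0 ≤ 1 - s := by linarith
  have e : (3 * s ^ 2 - 2 * s ^ 3) = s * (s * (s + (1 - s)) + (1 - s) * s) + (1 - s) * (s * s) := by
    ring
  have hE : ENNReal.ofReal (3 * s ^ 2 - 2 * s ^ 3) =
      ENNReal.ofReal s * (ENNReal.ofReal s * (ENNReal.ofReal s + ENNReal.ofReal (1 - s)) +
        ENNReal.ofReal (1 - s) * ENNReal.ofReal s) +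
        ENNReal.ofReal (1 - s) * (ENNReal.ofReal s * ENNReal.ofReal s) := by
    rw [e, ENNReal.ofReal_add (by positivity) (by positivity), ENNReal.ofReal_mul hs0,
      ENNReal.ofReal_add (by positivity) (by positivity), ENNReal.ofReal_mul hs0,
      ENNReal.ofReal_add hs0 hr0, ENNReal.ofReal_mul hr0, ENNReal.ofReal_mul hr0,
      ENNReal.ofReal_mul hs0]
  rw [hE]
  cases f x <;> simp

/-! ### Sequential runs within a shared budget -/

section Sequential

variable {m n : ℕ}

/-- Run a tree on the `i`-th instance with a budget `b`, and continue with the remaining budget and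
the answer. When the budget is used up, continue with budget `0` and the answer `g`. -/
def DTree.runWithin (i : Fin n) (g : Bool)
    (k : ℕ → Bool → DTree (Fin n × Fin m) (Fin n → Bool)) :
    DTree (Fin m) Bool → ℕ → DTree (Fin n × Fin m) (Fin n → Bool)
  -- Finishing exactly at the budget counts as exhaustion, so a run is accepted only if its cost is
  -- strictly below `b`. Hence budget `0` always means a coin flip for every remaining instance.
  | .leaf _, 0 => k 0 g
  | .leaf a, b + 1 => k (b + 1) a
  | .query _ _ _, 0 => k 0 g
  | .query j t₀ t₁, b + 1 => .query (i, j) (runWithin i g k t₀ b) (runWithin i g k t₁ b)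

theorem DTree.eval_runWithin (i : Fin n) (g : Bool)
    (k : ℕ → Bool → DTree (Fin n × Fin m) (Fin n → Bool)) (D : DTree (Fin m) Bool) (b : ℕ)
    (x : Fin n × Fin m → Bool) :
    (D.runWithin i g k b).eval x =
      (if D.cost (fun j => x (i, j)) < b then
        k (b - D.cost fun j => x (i, j)) (D.eval fun j => x (i, j)) else k 0 g).eval x := by
  induction D generalizing b with
  | leaf a => cases b <;> simp [runWithin, cost, eval]
  | query j t₀ t₁ ih₀ ih₁ =>
    cases b with
    | zero => simp [runWithin]
    | succ b =>
      cases h : x (i, j)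
      · simp [runWithin, cost, eval, h, ih₀, add_comm 1]
      · simp [runWithin, cost, eval, h, ih₁, add_comm 1]

theorem DTree.cost_runWithin_le (i : Fin n) (g : Bool)
    {k : ℕ → Bool → DTree (Fin n × Fin m) (Fin n → Bool)} {x : Fin n × Fin m → Bool}
    (hk : ∀ b a, (k b a).cost x ≤ b) (D : DTree (Fin m) Bool) (b : ℕ) :
    (D.runWithin i g k b).cost x ≤ b := by
  induction D generalizing b with
  | leaf a => cases b <;> exact hk _ _
  | query j t₀ t₁ ih₀ ih₁ =>
    cases b with
    | zero => exact hk _ _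
    | succ b =>
      have h₀ := ih₀ b
      have h₁ := ih₁ b
      simp only [runWithin, cost]
      split <;> omega

/-- Run independent copies of `R` on the instances in a list, within a budget, and write the answers
into a given vector; the instances left when the budget is used up are answered by coin flips. -/
noncomputable def sequentialAlg (R : RandAlg (Fin m) Bool) :
    List (Fin n) → PMF (ℕ → (Fin n → Bool) → DTree (Fin n × Fin m) (Fin n → Bool))
  | [] => PMF.pure fun _ o => .leaf o
  | i :: l => R.bind fun D => (PMF.uniformOfFintype Bool).bind fun g =>
      (sequentialAlg R l).map fun K b o =>
        D.runWithin i g (fun b' a => K b' (Function.update o i a)) b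

theorem cost_le_of_mem_support_sequentialAlg (R : RandAlg (Fin m) Bool) (l : List (Fin n))
    {K : ℕ → (Fin n → Bool) → DTree (Fin n × Fin m) (Fin n → Bool)}
    (hK : K ∈ (sequentialAlg R l).support) (b : ℕ) (o : Fin n → Bool)
    (x : Fin n × Fin m → Bool) : (K b o).cost x ≤ b := by
  induction l generalizing K b o with
  | nil =>
    simp only [sequentialAlg, PMF.support_pure, Set.mem_singleton_iff] at hK
    subst hK
    simp [DTree.cost]
  | cons i l ih =>
    simp only [sequentialAlg, PMF.mem_support_bind_iff, PMF.mem_support_map_iff] at hK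
    obtain ⟨D, -, g, -, K', hK', rfl⟩ := hK
    exact DTree.cost_runWithin_le i g (fun b' a => ih hK' b' _) D b

open Classical in
-- `H b j` is a potential bounding from below the probability that `j` remaining instances are all
-- answered correctly with budget `b`. A wrong answer is worth `0`; exhaustion costs a factor `1 /
-- 2` and leaves budget `0`.
theorem le_tsum_sequentialAlg (R : RandAlg (Fin m) Bool) (x : Fin n × Fin m → Bool)
    (y : Fin n → Bool) {H : ℕ → ℕ → ℝ≥0∞} {B N : ℕ} (h0 : ∀ b ≤ B, H b 0 ≤ 1)
    (hstep : ∀ i, ∀ b ≤ B, ∀ j < N, H b (j + 1) ≤ ∑' D, R D *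
      if D.cost (fun k => x (i, k)) < b then
        (if D.eval (fun k => x (i, k)) = y i then H (b - D.cost fun k => x (i, k)) j else 0)
      else 2⁻¹ * H 0 j)
    (l : List (Fin n)) (hl : l.length ≤ N) (b : ℕ) (hb : b ≤ B) (o : Fin n → Bool)
    (ho : ∀ i ∉ l, o i = y i) :
    H b l.length ≤ ∑' K, sequentialAlg R l K * if (K b o).eval x = y then 1 else 0 := by
  induction l generalizing b o with
  | nil =>
    have : o = y := funext fun i => ho i List.not_mem_nil
    simp only [sequentialAlg, PMF.tsum_pure_mul, DTree.eval, this, if_true]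
    exact h0 b hb
  | cons i l ih =>
    have hl' : l.length < N := hl
    simp only [sequentialAlg, PMF.tsum_bind_mul, PMF.tsum_map_mul, DTree.eval_runWithin]
    refine (hstep i b hb l.length hl').trans (ENNReal.tsum_le_tsum fun D => ?_)
    gcongr
    have hupd : ∀ k ∉ l, Function.update o i (y i) k = y k := by
      intro k hk
      by_cases hki : k = i
      · subst hki; simp
      · simpa [hki] using ho k (by simp [hki, hk])
    split_ifs with hc he
    · rw [PMF.tsum_const_mul]
      rw [he]
      exact ih hl'.le _ ((Nat.sub_le _ _).trans hb) _ hupd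
    · exact bot_le
    · refine le_trans ?_ (ENNReal.le_tsum (y i))
      rw [PMF.uniformOfFintype_apply, Fintype.card_bool, Nat.cast_ofNat]
      gcongr
      exact ih hl'.le _ (Nat.zero_le _) _ hupd

variable {X : Set (Fin m → Bool)}

theorem worstR_powFun_le (f : X → Bool) (R : RandAlg (Fin m) Bool) {H : ℕ → ℕ → ℝ≥0∞} {B : ℕ}
    (h0 : ∀ b ≤ B, H b 0 ≤ 1)
    (hstep : ∀ x : X, ∀ b ≤ B, ∀ j < n, H b (j + 1) ≤ ∑' D, R D *
      if D.cost x.1 < b then (if D.eval x.1 = f x then H (b - D.cost x.1) j else 0)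
      else 2⁻¹ * H 0 j) {s : ℝ} (hs : ENNReal.ofReal s ≤ H B n) :
    worstR (powFun f n) s ≤ B := by
  classical
  refine iInf₂_le_of_le ((sequentialAlg R (List.finRange n)).map fun K => K B fun _ => false)
    (fun x => ?_) ?_
  · rw [successProb_eq_tsum, PMF.tsum_map_mul]
    have := le_tsum_sequentialAlg R x.1 (powFun f n x) h0
      (fun i => hstep ⟨fun k => x.1 (i, k), x.2 i⟩) (List.finRange n) (by simp) B le_rfl
      (fun _ => false) (fun i hi => absurd (List.mem_finRange i) hi)
    rw [List.length_finRange] at this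
    exact hs.trans (this.trans_eq (tsum_congr fun K => by congr))
  · refine iSup₂_le fun x _ => iSup₂_le fun D hD => ?_
    simp only [PMF.mem_support_map_iff] at hD
    obtain ⟨K, hK, rfl⟩ := hD
    exact_mod_cast cost_le_of_mem_support_sequentialAlg R _ hK B _ x

open Classical in
-- Averages a pointwise bound `α ≤ h D + β * cost`. It is needed only for trees that answer
-- correctly, since the others do not contribute to `α * s`.
theorem ofReal_sub_le_tsum (f : X → Bool) (R : RandAlg (Fin m) Bool) (x : X) {s C α β : ℝ}
    (hα : 0 ≤ α) (hβ : 0 ≤ β) (hC : 0 ≤ C)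
    (hs : successProb f R x = ENNReal.ofReal s) (hc : expCost R x = ENNReal.ofReal C)
    {h : DTree (Fin m) Bool → ℝ≥0∞}
    (hh : ∀ D : DTree (Fin m) Bool, D.eval x.1 = f x →
      ENNReal.ofReal α ≤ h D + ENNReal.ofReal (β * D.cost x.1)) :
    ENNReal.ofReal (α * s - β * C) ≤ ∑' D, R D * h D := by
  rw [ENNReal.ofReal_sub _ (mul_nonneg hβ hC), tsub_le_iff_right, ENNReal.ofReal_mul hα,
    ENNReal.ofReal_mul hβ, ← hs, ← hc, successProb_eq_tsum, expCost, ← ENNReal.tsum_mul_left,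
    ← ENNReal.tsum_mul_left, ← ENNReal.tsum_add]
  refine ENNReal.tsum_le_tsum fun D => ?_
  by_cases hD : D.eval x.1 = f x
  · rw [if_pos hD, mul_one, mul_left_comm, ← mul_add, mul_comm]
    gcongr
    have := hh D hD
    rwa [ENNReal.ofReal_mul hβ, ENNReal.ofReal_natCast] at this
  · simp [hD]

/-- The budgeted sequential algorithm when the success probability dominates the cost. -/
theorem worstR_powFun_le_of_sub_cost (f : X → Bool) (R : RandAlg (Fin m) Bool) {s C : X → ℝ}
    (hC : ∀ x, 0 ≤ C x) (hs : ∀ x, successProb f R x = ENNReal.ofReal (s x))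
    (hc : ∀ x, expCost R x.1 = ENNReal.ofReal (C x)) {a l : ℝ} {B : ℕ} (ha : 1 ≤ a) (hl : 0 ≤ l)
    (h : ∀ x, a / 2 ≤ s x - l * C x) (hB : a ^ n * Real.exp (-(l * B)) ≤ 1 / 2) :
    worstR (powFun f n) ((a / 2) ^ n) ≤ B := by
  -- The target `(a / 2) ^ j`, discounted by `exp (-l)` for each unit of budget already spent.
  set G : ℝ → ℕ → ℝ := fun b j => (1 / 2) ^ j * (a ^ j * Real.exp (-(l * (B - b)))) with hG
  have hG0 : ∀ b j, 0 ≤ G b j := fun b j => by simp only [hG]; positivity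
  have hhalf : ∀ j : ℕ, ENNReal.ofReal ((1 / 2) ^ j) = 2⁻¹ ^ j := by
    intro j
    rw [ENNReal.ofReal_pow (by norm_num), one_div, ENNReal.ofReal_inv_of_pos two_pos]
    simp
  -- An overdrawn potential is at most the value of flipping coins for the current instance and the
  -- `j` remaining ones; this is where `hB` enters.
  have hGneg : ∀ b : ℝ, b ≤ 0 → ∀ j ≤ n, G b j ≤ 1 / 2 * (1 / 2) ^ j := by
    intro b hb j hj
    simp only [hG]
    rw [mul_comm]
    refine mul_le_mul_of_nonneg_right ?_ (by positivity)
    refine le_trans ?_ hB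
    refine mul_le_mul (pow_le_pow_right₀ ha hj) (Real.exp_le_exp.2 ?_) (Real.exp_nonneg _)
      (by positivity)
    nlinarith
  refine worstR_powFun_le f R (B := B)
    (H := fun b j => if b = 0 then 2⁻¹ ^ j else ENNReal.ofReal (G b j)) ?_ ?_ ?_
  · intro b hb
    split_ifs
    · simp
    · rw [ENNReal.ofReal_le_one]
      simp only [hG, pow_zero, one_mul]
      rw [Real.exp_le_one_iff]
      have : (b : ℝ) ≤ B := by exact_mod_cast hb
      nlinarith
  · intro x b hb j hj
    rcases Nat.eq_zero_or_pos b with rfl | hb0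
    · simp only [Nat.not_lt_zero, if_true, if_false]
      rw [PMF.tsum_const_mul, pow_succ']
    · simp only [hb0.ne', if_false, if_true]
      refine le_trans (ENNReal.ofReal_le_ofReal ?_) (ofReal_sub_le_tsum f R x (hG0 b j)
        (mul_nonneg (hG0 b j) hl) (hC x) (hs x) (hc x) fun D hD => ?_)
      · have e : G b (j + 1) = G b j * (a / 2) := by simp only [hG]; ring
        have := mul_le_mul_of_nonneg_left (h x) (hG0 b j)
        rw [e]
        linarith
      · have hexp : G b j ≤ G (b - D.cost x.1) j + G b j * l * D.cost x.1 := by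
          have e : G (b - D.cost x.1) j = G b j * Real.exp (-(l * D.cost x.1)) := by
            simp only [hG]
            rw [mul_assoc, mul_assoc, ← Real.exp_add]
            congr 3
            ring
          rw [e]
          have := mul_le_mul_of_nonneg_left (Real.add_one_le_exp (-(l * D.cost x.1))) (hG0 b j)
          linarith
        refine (ENNReal.ofReal_le_ofReal hexp).trans (ENNReal.ofReal_add_le.trans ?_)
        gcongr
        split_ifs with h1 h2
        · omega
        · rw [Nat.cast_sub h1.le]
        · rw [← hhalf, ← ENNReal.ofReal_ofNat 2, ← ENNReal.ofReal_inv_of_pos two_pos,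
            ← ENNReal.ofReal_mul (by norm_num), ← one_div]
          refine ENNReal.ofReal_le_ofReal (hGneg _ ?_ j hj.le)
          have : (b : ℝ) ≤ D.cost x.1 := by exact_mod_cast not_lt.1 h1
          linarith
  · have hB0 : B ≠ 0 := by
      rintro rfl
      have := one_le_pow₀ (n := n) ha
      norm_num at hB
      linarith
    rw [if_neg hB0]
    refine ENNReal.ofReal_le_ofReal (le_of_eq ?_)
    simp only [hG, sub_self, mul_zero, neg_zero, Real.exp_zero, mul_one]
    rw [← mul_pow]
    congr 1
    ring

/-- The budgeted sequential algorithm, with the conditional cost bounded by Markov's inequality. -/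
theorem worstR_powFun_le_of_markov (f : X → Bool) (R : RandAlg (Fin m) Bool) {s C : X → ℝ}
    (hC : ∀ x, 0 ≤ C x) (hs : ∀ x, successProb f R x = ENNReal.ofReal (s x))
    (hc : ∀ x, expCost R x.1 = ENNReal.ofReal (C x)) {γ K : ℝ} {B : ℕ} (hγ : 0 ≤ γ) (hB : 0 < B)
    (hK : 0 ≤ K) (hγs : ∀ x, γ ≤ s x) (hCK : ∀ x, C x ≤ γ * K) :
    worstR (powFun f n) (γ ^ n * ((B - n * K) / B)) ≤ B := by
  have hBr : (0 : ℝ) < B := by exact_mod_cast hB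
  refine worstR_powFun_le f R (B := B)
    -- Linear potential: each instance is charged `K` units of budget, and `s * (b - j * K) - C ≥ γ
    -- * (b - j * K) - γ * K` closes the recursion. `ENNReal.ofReal` truncates negative values,
    -- where the claim is trivial.
    (H := fun b j => ENNReal.ofReal (γ ^ j * ((b - j * K) / B))) ?_ ?_ le_rfl
  · intro b hb
    have : (b : ℝ) ≤ B := by exact_mod_cast hb
    rw [ENNReal.ofReal_le_one]
    simp only [pow_zero, one_mul, Nat.cast_zero, zero_mul, sub_zero]
    rwa [div_le_one hBr]
  · intro x b hb j _
    rcases le_or_gt ((b : ℝ) - (j + 1 : ℕ) * K) 0 with hneg | hpos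
    · rw [ENNReal.ofReal_of_nonpos]
      · exact bot_le
      · exact mul_nonpos_of_nonneg_of_nonpos (by positivity)
          (div_nonpos_of_nonpos_of_nonneg hneg hBr.le)
    · push_cast at hpos
      have hbj : 0 ≤ (b : ℝ) - j * K := by nlinarith
      refine le_trans (ENNReal.ofReal_le_ofReal ?_) (ofReal_sub_le_tsum f R x
        (α := γ ^ j * ((b - j * K) / B)) (β := γ ^ j / B) (by positivity) (by positivity)
        (hC x) (hs x) (hc x) fun D hD => ?_)
      · have e1 : γ ^ (j + 1) * ((b - (j + 1 : ℕ) * K) / B) =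
            γ ^ j / B * (γ * (b - j * K) - γ * K) := by push_cast; ring
        have e2 : γ ^ j * ((b - j * K) / B) * s x - γ ^ j / B * C x =
            γ ^ j / B * (s x * (b - j * K) - C x) := by ring
        rw [e1, e2]
        refine mul_le_mul_of_nonneg_left ?_ (by positivity)
        have := mul_le_mul_of_nonneg_right (hγs x) hbj
        linarith [hCK x]
      · split_ifs with h1
        · rw [Nat.cast_sub h1.le]
          refine le_trans (le_of_eq ?_) ENNReal.ofReal_add_le
          congr 1
          ring
        -- An exhausted run has cost at least `b ≥ b - j * K`, so the cost term alone suffices and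
        -- the coin flips are ignored.
        · refine le_add_left (ENNReal.ofReal_le_ofReal ?_)
          have hcb : (b : ℝ) ≤ D.cost x.1 := by exact_mod_cast not_lt.1 h1
          rw [div_mul_eq_mul_div, ← mul_div_assoc]
          gcongr
          nlinarith [mul_nonneg (Nat.cast_nonneg (α := ℝ) j) hK]

end Sequential

/-! ### The upper bound -/

section UpperBound

variable {m n : ℕ} {X : Set (Fin m → Bool)}

theorem worstR_mono {ι O : Type} {X : Set (ι → Bool)} (f : X → O) {s t : ℝ} (h : s ≤ t) :
    worstR f s ≤ worstR f t :=
  le_iInf₂ fun R hR => iInf₂_le R fun x => (ENNReal.ofReal_le_ofReal h).trans (hR x)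

theorem worstR_powFun_of_const (f : X → Bool) {c : Bool} (hf : ∀ x, f x = c) {s : ℝ}
    (hs : s ≤ 1) : worstR (powFun f n) s = 0 := by
  refine le_antisymm (iInf₂_le_of_le (PMF.pure (.leaf fun _ => c)) (fun x => ?_) ?_) bot_le
  · have : powFun f n x = fun _ => c := funext fun i => hf _
    rw [successProb, PMF.pure_map, this]
    simpa [DTree.eval] using hs
  · simp [worstCost, DTree.cost]

/-- Under the uniform distribution on `x₀`, `x₁`, a leaf succeeds with probability `1 / 2` and any
other tree costs at least `1`, so success is at most `1 / 2` plus cost. This later gives `1 ≤ n *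
T`, which absorbs the rounding of the budget. -/
theorem ofReal_sub_half_le_maxDistR (f : X → Bool) {x₀ x₁ : X} (h₀ : f x₀ = false)
    (h₁ : f x₁ = true) (γ : ℝ) : ENNReal.ofReal (γ - 1 / 2) ≤ maxDistR f γ := by
  classical
  set μ : PMF X := (PMF.uniformOfFintype Bool).map fun b => if b then x₁ else x₀ with hμ
  have hsum : ∀ F : X → ℝ≥0∞, ∑' x, μ x * F x = 2⁻¹ * (F x₁ + F x₀) := by
    intro F
    rw [hμ, PMF.tsum_map_mul, tsum_fintype, Fintype.sum_bool]
    simp [mul_add]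
  refine le_iSup_of_le μ (le_iInf₂ fun R hR => ?_)
  rw [ENNReal.ofReal_sub _ (by norm_num), tsub_le_iff_left]
  refine hR.trans ?_
  have h2 : ENNReal.ofReal (1 / 2) = ∑' D, R D * 2⁻¹ := by
    rw [PMF.tsum_const_mul, one_div, ENNReal.ofReal_inv_of_pos two_pos, ENNReal.ofReal_ofNat]
  rw [avgSuccess, avgCost, hsum, hsum, h2, ← ENNReal.tsum_add,
    ← ENNReal.tsum_mul_left, ← ENNReal.tsum_add, successProb_eq_tsum, successProb_eq_tsum,
    ← ENNReal.tsum_add, ← ENNReal.tsum_mul_left]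
  refine ENNReal.tsum_le_tsum fun D => ?_
  rw [← mul_add, ← mul_add, mul_left_comm, mul_left_comm 2⁻¹, ← mul_add]
  gcongr
  rw [h₀, h₁]
  cases D with
  | leaf o => cases o <;> simp [DTree.eval]
  | query j t₀ t₁ =>
    have hle : ∀ (p : Prop) {_ : Decidable p} (c : ℕ),
        (if p then 1 else 0 : ℝ≥0∞) ≤ ((1 + c : ℕ) : ℝ≥0∞) := by
      intro p _ c
      push_cast
      split_ifs
      · exact le_self_add
      · exact bot_le
    refine le_trans ?_ le_add_self
    gcongr
    · exact hle _ _
    · exact hle _ _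

/-- Minimax: one randomized algorithm that achieves on every input the trade-off between success
and cost which is guaranteed by the distributional complexity. -/
theorem exists_randAlg_sub_cost_ge [Fintype X] [Nonempty X] (f : X → Bool) {γ T l v : ℝ}
    (hT0 : 0 ≤ T) (hT : maxDistR f γ ≤ ENNReal.ofReal T) (hl : 0 < l) (hv0 : 0 ≤ v)
    (hv : v < γ - l * T) :
    ∃ (R : RandAlg (Fin m) Bool) (s C : X → ℝ), (∀ x, 0 ≤ s x) ∧ (∀ x, s x ≤ 1) ∧
      (∀ x, 0 ≤ C x) ∧ (∀ x, successProb f R x = ENNReal.ofReal (s x)) ∧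
      (∀ x, expCost R x.1 = ENNReal.ofReal (C x)) ∧ ∀ x, v ≤ s x - l * C x := by
  classical
  set ok : X → DTree (Fin m) Bool → ℝ := fun x D => if f x = D.eval x.1 then 1 else 0 with hok
  have hok0 : ∀ x D, 0 ≤ ok x D := fun x D => by simp only [hok]; split <;> norm_num
  have hok1 : ∀ x D, ok x D ≤ 1 := fun x D => by simp only [hok]; split <;> norm_num
  set g : DTree (Fin m) Bool → X → ℝ := fun D x => ok x D - l * D.cost x.1 with hg
  obtain ⟨v', hvv', hv'⟩ := exists_between hv
  have hex : ∀ w : X → ℝ, (∀ x, 0 ≤ w x) → ∑ x, w x = 1 →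
      ∃ D, ∑ x, w x * v' ≤ ∑ x, w x * g D x := by
    intro w hw0 hw1
    by_contra! hcon
    rw [← Finset.sum_mul, hw1, one_mul] at hcon
    set μ : PMF X := PMF.ofFintype (fun x => ENNReal.ofReal (w x)) (by
      rw [← ENNReal.ofReal_sum_of_nonneg fun x _ => hw0 x, hw1, ENNReal.ofReal_one]) with hμ
    have hμw : (fun x => (μ x).toReal) = w :=
      funext fun x => ENNReal.toReal_ofReal (hw0 x)
    -- If every tree had payoff below `v'` under `μ`, success `γ` would cost at least `(γ - v') /
    -- l`, which exceeds `T`.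
    have hdist : ENNReal.ofReal ((γ - v') / l) ≤ distR f μ γ := by
      refine le_iInf₂ fun R hR => ?_
      rw [ENNReal.ofReal_div_of_pos hl]
      refine ENNReal.div_le_of_le_mul ?_
      rw [ENNReal.ofReal_sub _ (hv0.trans hvv'.le), tsub_le_iff_left]
      refine hR.trans ?_
      rw [avgSuccess_eq_tsum, avgCost_eq_tsum, hμw, ← PMF.tsum_const_mul R (ENNReal.ofReal v'),
        ← ENNReal.tsum_mul_right, ← ENNReal.tsum_add]
      refine ENNReal.tsum_le_tsum fun D => ?_
      have hm0 : 0 ≤ massCost w D Set.univ := by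
        rw [← hμw]; exact (isReward_success f μ).massCost_nonneg D _
      rw [mul_assoc, ← mul_add, ← ENNReal.ofReal_mul hm0,
        ← ENNReal.ofReal_add (hv0.trans hvv'.le) (mul_nonneg hm0 hl.le)]
      gcongr
      have := hcon D
      simp only [hg, hok, mul_sub, Finset.sum_sub_distrib] at this
      simp only [gain, massCost, Set.indicator_univ, Finset.sum_mul]
      have e : ∑ x, w x * (l * (D.cost x.1 : ℝ)) = ∑ x, w x * (D.cost x.1 : ℝ) * l :=
        Finset.sum_congr rfl fun x _ => by ring
      linarith
    have h1 := hdist.trans ((le_iSup (fun μ => distR f μ γ) μ).trans hT)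
    rw [ENNReal.ofReal_le_ofReal_iff hT0, div_le_iff₀ hl] at h1
    linarith
  obtain ⟨s, hs, hlt⟩ := exists_mem_convexHull_forall_lt g (fun _ => v') (sub_pos.2 hvv') hex
  obtain ⟨R, E, hE, hE1, hEpos, hER⟩ := exists_pmf_of_mem_convexHull g hs
  refine ⟨R, fun x => E (ok x), fun x => E fun D => D.cost x.1, fun x => hEpos _ (hok0 x),
    fun x => ?_, fun x => hEpos _ fun D => Nat.cast_nonneg _, fun x => ?_, fun x => ?_,
    fun x => ?_⟩
  · have := hEpos ((fun _ => 1) - ok x) fun D => sub_nonneg.2 (hok1 x D)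
    rw [map_sub, hE1] at this
    linarith
  · rw [← hER _ (hok0 x), successProb_eq_tsum]
    refine tsum_congr fun D => ?_
    by_cases hD : D.eval x.1 = f x
    · simp [hok, hD]
    · simp [hok, hD, Ne.symm hD]
  · rw [← hER _ fun D => Nat.cast_nonneg _, expCost]
    simp
  · have e : (fun D => g D x) = ok x - l • fun D : DTree (Fin m) Bool => (D.cost x.1 : ℝ) := rfl
    have h1 := hE x
    have h2 := hlt x
    rw [e, map_sub, map_smul, smul_eq_mul] at h1
    linarith

theorem expCost_majorityAlg_ofReal {R : RandAlg (Fin m) Bool} {x : Fin m → Bool} {C : ℝ}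
    (h : expCost R x = ENNReal.ofReal C) :
    expCost (majorityAlg R) x = ENNReal.ofReal (3 * C) := by
  rw [expCost_majorityAlg, h, ENNReal.ofReal_mul (by norm_num), ENNReal.ofReal_ofNat]

theorem worstR_powFun_le_of_gamma_le [Fintype X] [Nonempty X] (f : X → Bool) {γ T : ℝ}
    (hγ : 1 / 2 < γ) (hγ' : γ ≤ 3 / 4) (hT : maxDistR f γ ≤ ENNReal.ofReal T)
    (hTγ : γ - 1 / 2 ≤ T) (hn : 100 / (2 * γ - 1) ^ 2 ≤ n) :
    worstR (powFun f n) (γ ^ n) ≤ ENNReal.ofReal (1300 * (n * T)) := by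
  obtain ⟨δ, hδ⟩ : ∃ δ, δ = 2 * γ - 1 := ⟨_, rfl⟩
  have hγδ : γ = (1 + δ) / 2 := by rw [hδ]; ring
  rw [← hδ] at hn
  have hδ0 : 0 < δ := by linarith
  have hδ1 : δ ≤ 1 / 2 := by linarith
  have hTδ : δ / 2 ≤ T := by linarith
  have hT0 : 0 < T := by linarith
  have hnδ2 : 100 ≤ n * δ ^ 2 := by rwa [div_le_iff₀ (by positivity)] at hn
  have hnδ : 100 ≤ n * δ := by
    have : (n : ℝ) * δ ^ 2 ≤ n * δ := by
      gcongr
      nlinarith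
    linarith
  have hnT : 1 ≤ n * T := by
    have : (n : ℝ) * (δ / 2) ≤ n * T := by gcongr
    linarith
  -- The penalty `l * T = δ / 20` is below the loss `γ - v = δ / 10` that is conceded here and
  -- regained by the majority vote.
  obtain ⟨R, s, C, hs0, hs1, hC0, hs, hC, hsC⟩ := exists_randAlg_sub_cost_ge f hT0.le hT
    (l := δ / (20 * T)) (v := (1 + 8 / 10 * δ) / 2) (by positivity) (by positivity) (by
      have : δ / (20 * T) * T = δ / 20 := by field_simp
      rw [this]
      linarith)
  set B := ⌈1200 * (n * T)⌉₊ with hB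
  have hB1 : 1200 * (n * T) ≤ B := Nat.le_ceil _
  have hB2 : (B : ℝ) ≤ 1300 * (n * T) := by
    have := (Nat.ceil_lt_add_one (show 0 ≤ 1200 * (n * T) by positivity)).le
    linarith
  have hBle : (B : ℝ≥0∞) ≤ ENNReal.ofReal (1300 * (n * T)) := by
    rw [← ENNReal.ofReal_natCast]
    exact ENNReal.ofReal_le_ofReal hB2
  refine le_trans ?_ hBle
  rw [hγδ]
  refine worstR_powFun_le_of_sub_cost f (majorityAlg R)
    (s := fun x => 3 * s x ^ 2 - 2 * s x ^ 3) (C := fun x => 3 * C x)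
    (fun x => mul_nonneg (by norm_num) (hC0 x))
    (fun x => successProb_majorityAlg f R x (hs0 x) (hs x))
    (fun x => expCost_majorityAlg_ofReal (hC x)) (l := δ / (600 * T)) (by linarith)
    (by positivity) (fun x => ?_) ?_
  · have h1 := hsC x
    obtain ⟨c, hc⟩ : ∃ c, c = δ / (20 * T) * C x := ⟨_, rfl⟩
    have hc0 : 0 ≤ c := by rw [hc]; have := hC0 x; positivity
    have e : δ / (600 * T) * (3 * C x) = c / 10 := by rw [hc]; field_simp; ring
    rw [← hc] at h1
    rw [e]
    obtain ⟨β, hβ⟩ : ∃ β, β = 2 * s x - 1 := ⟨_, rfl⟩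
    have hsβ : s x = (1 + β) / 2 := by rw [hβ]; ring
    have hβ1 : β ≤ 1 := by have := hs1 x; linarith
    have hβ0 : 8 / 10 * δ ≤ β := by linarith
    -- Majority turns advantage `β` into `β * (3 / 2 - β ^ 2 / 2)`. Since `c ≤ (β - 8 / 10 * δ) /
    -- 2`, subtracting the cost term `c / 10` leaves exactly this inequality to reach `(1 + δ) / 2`.
    -- For large `β` the bracket is at least `9 / 10`; otherwise `β ≤ 6 / 10` and `β ≥ 8 / 10 * δ`
    -- suffice.
    have key : 92 / 100 * δ ≤ β * (14 / 10 - β ^ 2 / 2) := by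
      rcases le_or_gt (92 / 100 * δ) (9 / 10 * β) with hcase | hcase
      · nlinarith
      · have : β ≤ 6 / 10 := by linarith
        nlinarith
    rw [hsβ] at h1 ⊢
    nlinarith
  · have h1 : (1 + δ) ^ n ≤ Real.exp (n * δ) := by
      rw [Real.exp_nat_mul]
      gcongr
      linarith [Real.add_one_le_exp δ]
    -- The constant `1200` makes the total discount exponent at least `2 * n * δ`, twice what
    -- cancels `(1 + δ) ^ n`.
    have h2 : n * δ + 1 ≤ δ / (600 * T) * B := by
      have : δ / (600 * T) * (1200 * (n * T)) ≤ δ / (600 * T) * B := by gcongr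
      have e : δ / (600 * T) * (1200 * (n * T)) = 2 * (n * δ) := by field_simp; ring
      linarith
    calc (1 + δ) ^ n * Real.exp (-(δ / (600 * T) * B))
        ≤ Real.exp (n * δ) * Real.exp (-(n * δ + 1)) := by gcongr
      _ = Real.exp (-1) := by rw [← Real.exp_add]; congr 1; ring
      _ ≤ 1 / 2 := by
        rw [Real.exp_neg, one_div]
        gcongr
        linarith [Real.add_one_le_exp 1]

theorem worstR_powFun_le_of_le_gamma [Fintype X] [Nonempty X] (f : X → Bool) {γ T : ℝ}
    (hγ : 3 / 4 < γ) (hγ1 : γ < 1) (hT : maxDistR f γ ≤ ENNReal.ofReal T)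
    (hTγ : γ - 1 / 2 ≤ T) (hn : 100 / (1 - γ) ^ 2 ≤ n) :
    worstR (powFun f n) (γ ^ n) ≤ ENNReal.ofReal (1300 * (n * T)) := by
  obtain ⟨e, he⟩ : ∃ e, e = 1 - γ := ⟨_, rfl⟩
  have hγe : γ = 1 - e := by rw [he]; ring
  rw [← he] at hn
  have he0 : 0 < e := by linarith
  have he1 : e < 1 / 4 := by linarith
  have hT4 : 1 / 4 ≤ T := by linarith
  have hT0 : 0 < T := by linarith
  have hne2 : 100 ≤ n * e ^ 2 := by rwa [div_le_iff₀ (by positivity)] at hn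
  have hne : 100 ≤ n * e := by
    have : (n : ℝ) * e ^ 2 ≤ n * e := by
      gcongr
      nlinarith
    linarith
  have hnT : 1 ≤ n * T := by nlinarith
  obtain ⟨R, s, C, hs0, hs1, hC0, hs, hC, hsC⟩ := exists_randAlg_sub_cost_ge f hT0.le hT
    (l := e / (10 * T)) (v := 1 - 12 / 10 * e) (by positivity) (by linarith) (by
      have : e / (10 * T) * T = e / 10 := by field_simp
      rw [this]
      linarith)
  set B := ⌈96 * (n * T)⌉₊ with hB
  have hB1 : 96 * (n * T) ≤ B := Nat.le_ceil _
  have hB2 : (B : ℝ) ≤ 1300 * (n * T) := by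
    have := (Nat.ceil_lt_add_one (show 0 ≤ 96 * (n * T) by positivity)).le
    linarith
  have hB0 : (0 : ℝ) < B := by linarith
  have hBle : (B : ℝ≥0∞) ≤ ENNReal.ofReal (1300 * (n * T)) := by
    rw [← ENNReal.ofReal_natCast]
    exact ENNReal.ofReal_le_ofReal hB2
  refine le_trans ((worstR_mono _ ?_).trans (worstR_powFun_le_of_markov f (majorityAlg R)
    (s := fun x => 3 * s x ^ 2 - 2 * s x ^ 3) (C := fun x => 3 * C x)
    (fun x => mul_nonneg (by norm_num) (hC0 x))
    (fun x => successProb_majorityAlg f R x (hs0 x) (hs x))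
    (fun x => expCost_majorityAlg_ofReal (hC x)) (γ := 1 - 87 / 100 * e) (K := 48 * T)
    (by linarith) (by exact_mod_cast hB0) (by positivity) (fun x => ?_) fun x => ?_)) hBle
  -- Error `1 - γ = e` has been reduced to `87 / 100 * e`. By Bernoulli the surplus compounds to a
  -- factor `2` over `n` instances, which pays for the factor `(B - n * K) / B ≥ 1 / 2` due to `B ≥
  -- 96 * n * T = 2 * n * K`.
  · have h1 : 2 * γ ^ n ≤ (1 - 87 / 100 * e) ^ n := by
      calc 2 * γ ^ n ≤ (1 + n * (13 / 100 * e)) * γ ^ n := by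
            gcongr
            linarith
        _ ≤ (1 + 13 / 100 * e) ^ n * γ ^ n := by
            gcongr
            exact one_add_mul_le_pow (by linarith) n
        _ = ((1 + 13 / 100 * e) * γ) ^ n := (mul_pow _ _ _).symm
        _ ≤ (1 - 87 / 100 * e) ^ n := by
            gcongr
            rw [hγe]
            nlinarith
    have h2 : 1 / 2 ≤ ((B : ℝ) - n * (48 * T)) / B := by
      rw [le_div_iff₀ hB0]
      linarith
    have h3 : 0 ≤ (1 - 87 / 100 * e) ^ n := pow_nonneg (by linarith) n
    have := mul_le_mul_of_nonneg_left h2 h3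
    linarith
  · have h1 := hsC x
    have h2 : 0 ≤ e / (10 * T) * C x := by have := hC0 x; positivity
    obtain ⟨q, hq⟩ : ∃ q, q = 1 - s x := ⟨_, rfl⟩
    have hsq : s x = 1 - q := by rw [hq]; ring
    have hq0 : 0 ≤ q := by have := hs1 x; linarith
    have hq1 : q ≤ 12 / 10 * e := by linarith
    have hq2 : q ≤ 3 / 10 := by linarith
    -- Majority turns error `q` into `q ^ 2 * (3 - 2 * q) ≤ 72 / 100 * q`, and `72 / 100 * 12 / 10 <
    -- 87 / 100`.
    have : q * (3 - 2 * q) ≤ 72 / 100 := by nlinarith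
    have := mul_le_mul_of_nonneg_left this hq0
    rw [hsq]
    nlinarith
  · have h1 := hsC x
    have h2 := hs1 x
    have h3 : e / (10 * T) * C x ≤ 12 / 10 * e := by linarith
    -- So the majority costs at most `36 * T`, which is below `(1 - 87 / 100 * e) * (48 * T)` as `e
    -- < 1 / 4`.
    have h4 : C x ≤ 12 * T := by
      rw [div_mul_eq_mul_div, div_le_iff₀ (by positivity)] at h3
      have : e * C x ≤ e * (12 * T) := by linarith
      exact le_of_mul_le_mul_left this he0
    nlinarith

theorem worstR_powFun_le_maxDistR (f : X → Bool) {γ : ℝ} (hγ : 1 / 2 < γ) (hγ1 : γ < 1)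
    (hn : 100 / (min (2 * γ - 1) (1 - γ)) ^ 2 ≤ n) :
    worstR (powFun f n) (γ ^ n) ≤ ENNReal.ofReal 1300 * ((n : ℝ≥0∞) * maxDistR f γ) := by
  have hmin : 0 < min (2 * γ - 1) (1 - γ) := lt_min (by linarith) (by linarith)
  have hn0 : (n : ℝ≥0∞) ≠ 0 := by
    have : (0 : ℝ) < n := lt_of_lt_of_le (by positivity) hn
    exact_mod_cast this.ne'
  -- A constant `f` (including empty `X`) needs no queries; it must be treated apart because the
  -- bound `γ - 1 / 2 ≤ T` requires both values.
  by_cases hconst : ∃ c, ∀ x, f x = c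
  · obtain ⟨c, hc⟩ := hconst
    rw [worstR_powFun_of_const f hc (pow_le_one₀ (by linarith) hγ1.le)]
    exact bot_le
  push Not at hconst
  obtain ⟨x₀, h₀⟩ := hconst true
  obtain ⟨x₁, h₁⟩ := hconst false
  simp only [ne_eq, Bool.not_eq_true, Bool.not_eq_false] at h₀ h₁
  have hlow := ofReal_sub_half_le_maxDistR f h₀ h₁ γ
  by_cases htop : maxDistR f γ = ⊤
  · rw [htop, ENNReal.mul_top hn0, ENNReal.mul_top (by simp)]
    exact le_top
  have : Nonempty X := ⟨x₀⟩
  have := Fintype.ofFinite X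
  obtain ⟨T, hT⟩ : ∃ T, T = (maxDistR f γ).toReal := ⟨_, rfl⟩
  have hTm : maxDistR f γ = ENNReal.ofReal T := by rw [hT, ENNReal.ofReal_toReal htop]
  have hT0 : 0 ≤ T := hT ▸ ENNReal.toReal_nonneg
  have hTγ : γ - 1 / 2 ≤ T := by rwa [hTm, ENNReal.ofReal_le_ofReal_iff hT0] at hlow
  have e : ENNReal.ofReal 1300 * ((n : ℝ≥0∞) * maxDistR f γ) =
      ENNReal.ofReal (1300 * (n * T)) := by
    rw [hTm, ENNReal.ofReal_mul (by norm_num), ENNReal.ofReal_mul (Nat.cast_nonneg n),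
      ENNReal.ofReal_natCast]
  rw [e]
  rcases le_or_gt γ (3 / 4) with hcase | hcase
  · refine worstR_powFun_le_of_gamma_le f hγ hcase hTm.le hTγ (le_trans ?_ hn)
    gcongr
    exact min_le_left _ _
  · refine worstR_powFun_le_of_le_gamma f hcase hγ1 hTm.le hTγ (le_trans ?_ hn)
    gcongr
    exact min_le_right _ _

end UpperBound

theorem theorem1 :
    -- the lower bound, for success probability
    (∃ c : ℝ, 0 < c ∧
      ∀ (m : ℕ) (X : Set (Fin m → Bool)) (f : X → Bool) (γ : ℝ) (n : ℕ),
        1 / 2 < γ → γ < 1 → 1 ≤ n →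
        ENNReal.ofReal c * ((n : ℝ≥0∞) * maxDistR f γ) ≤ worstR (powFun f n) (γ ^ n)) ∧
    -- the matching upper bound, for success probability and large `n`
    (∃ c C : ℝ, 0 < c ∧ 0 < C ∧
      ∀ (m : ℕ) (X : Set (Fin m → Bool)) (f : X → Bool) (γ : ℝ) (n : ℕ),
        1 / 2 < γ → γ < 1 → c / (min (2 * γ - 1) (1 - γ)) ^ 2 ≤ (n : ℝ) →
        worstR (powFun f n) (γ ^ n) ≤ ENNReal.ofReal C * ((n : ℝ≥0∞) * maxDistR f γ)) ∧
    -- the lower bound, for arbitrary score measures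
    (∃ c : ℝ, 0 < c ∧
      ∀ (φ : ℝ → ℝ), IsScoreFunction φ →
      ∀ (m : ℕ) (X : Set (Fin m → Bool)) (f : X → Bool) (γ : ℝ) (n : ℕ),
        1 / 2 < γ → γ < 1 → 1 ≤ n →
        ENNReal.ofReal c * ((n : ℝ≥0∞) * maxDistScoreR φ f γ) ≤
          worstPowScoreR φ f n (γ ^ n)) := by
  refine ⟨⟨1 / 2, by norm_num, fun m X f γ n hγ hγ1 hn => ?_⟩,
    ⟨100, 1300, by norm_num, by norm_num, fun m X f γ n hγ hγ1 hn =>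
      worstR_powFun_le_maxDistR f hγ hγ1 hn⟩,
    ⟨1 / 2, by norm_num, fun φ hφ m X f γ n hγ hγ1 hn => ?_⟩⟩
  · have := Fintype.ofFinite X
    exact half_mul_maxDistR_le_worstR f hn (by linarith) hγ1
  · have := Fintype.ofFinite X
    exact half_mul_maxDistScoreR_le_worstPowScoreR hφ f hn (by linarith) hγ1
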